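/- Let $\mathbb F=\mathbb R$ or $\mathbb C$, let $m\ge 1$, and let $p\colon M_2\to M_1$ be a Riemannian covering (a smooth covering map that is a local isometry) of connected, Hausdorff, second countable $m$-dimensional Riemannian manifolds with possibly empty smooth boundary. Neither completeness nor compactness is assumed. Let $E_1\to M_1$ be a smooth vector bundle over $\mathbb F$ of finite rank with a smooth fibre metric (Riemannian if $\mathbb F=\mathbb R$, Hermitian if $\mathbb F=\mathbb C$) and a smooth $\mathbb F$-linear connection $\nabla$, not necessarily compatible with the metric. Let $D_1\colon\Gamma(E_1)\to\Gamma(E_1)$ be a linear differential operator of arbitrary order $d$ on smooth sections, that is, in local coordinates and local trivializations $D_1=\sum_{|\alpha|\le d}A^\alpha\,\partial^\alpha$ with smooth $\mathbb F$-matrix-valued coefficients $A^\alpha$. Let $E_2=p^*E_1$, with the pulled-back metric and connection, and let $D_2\colon\Gamma(E_2)\to\Gamma(E_2)$ be the lift of $D_1$: $(D_2\eta)(z)=(D_1\sigma)(p(z))$ whenever $\sigma\in\Gamma(E_1)$ and $\eta=p^*\sigma$ near $z$. Let $a_1,b_1\colon\partial M_1\to\mathbb F$ be arbitrary functions, let $a_2=a_1\circ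 p$ and $b_2=b_1\circ p$ on $\partial M_2$, let $n$ be the inward pointing unit normal of $\partial M_2$, and put $$\mathcal D(D_2)=\{\eta\in\Gamma_c(E_2): a_2\nabla_n\eta+b_2\eta=0 \text{ on } \partial M_2\},$$ where $\Gamma_c(E_2)$ is the space of compactly supported smooth sections (so $\mathcal D(D_2)=\Gamma_c(E_2)$ if $\partial M_2=\emptyset$). Regard $D_2\colon\mathcal D(D_2)\subset L^2(E_2)\to L^2(E_2)$ as an unbounded operator, where $L^2(E_2)$ is the completion of $\Gamma_c(E_2)$ for the inner product $\int_{M_2}\langle\eta,\theta\rangle\,d\mathrm{vol}$. For an operator $A\colon\mathcal D(A)\subset H\to H$ on a Hilbert space over $\mathbb F$, let $$\sigma(A)=\{\lambda\in\mathbb F: A-\lambda\colon\mathcal D(A)\to H\text{ is not bijective}\},\qquad \sigma_{\mathrm{ess}}(A)=\{\lambda\in\mathbb F: A-\lambda\colon\mathcal D(A)\to H\text{ is not Fredholm}\},$$ where Fredholm means that the kernel is finite-dimensional and the range is closed and of finite codimension. Suppose that $D_2$ is essentially self-adjoint, i.e. its closure $\overline{D}_2$ is self-adjoint, and that the group of deck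 transformations of $p$ (homeomorphisms $g$ of $M_2$ with $p\circ g=p$) is infinite. Then $\overline{D}_2$ has no eigenvalue of finite multiplicity (for no $\lambda\in\mathbb F$ is $\ker(\overline{D}_2-\lambda)$ both non-zero and finite-dimensional), and $$\sigma(\overline{D}_2)=\sigma_{\mathrm{ess}}(\overline{D}_2).$$ -/

import Mathlib

open Set Filter Topology MeasureTheory Bundle Manifold
open scoped ContDiff

set_option linter.unusedSectionVars false
namespace RiemCover
noncomputable section Volume

variable {m : ℕ} [NeZero m]
  {M : Type*} [TopologicalSpace M] [ChartedSpace (EuclideanHalfSpace m) M]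
  [RiemannianBundle (fun x : M ↦ TangentSpace (𝓡∂ m) x)]

/-- The Jacobian `√det ⟨L eᵢ, L eⱼ⟩` of a linear map `L` into the tangent space at `x`. -/
def tangentJacobian (x : M)
    (L : EuclideanSpace ℝ (Fin m) →L[ℝ] TangentSpace (𝓡∂ m) x) : ℝ :=
  √(Matrix.gram (E := TangentSpace (𝓡∂ m) x) ℝ fun i : Fin m ↦
    L (EuclideanSpace.single i (1 : ℝ))).det

/-- The density `√det (g_ij)` of the Riemannian metric in the chart `φ`, as a function on
coordinate space; here `g_ij = ⟨∂ᵢ, ∂ⱼ⟩` and `∂ᵢ = d(φ⁻¹)(eᵢ)`. -/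
def volumeDensity (φ : OpenPartialHomeomorph M (EuclideanHalfSpace m))
    (u : EuclideanSpace ℝ (Fin m)) : ℝ :=
  tangentJacobian ((φ.extend (𝓡∂ m)).symm u)
    (mfderivWithin 𝓘(ℝ, EuclideanSpace ℝ (Fin m)) (𝓡∂ m) (φ.extend (𝓡∂ m)).symm
      (range (𝓡∂ m)) u)

variable [MeasurableSpace M]

/-- The measure `√(det g_ij) dx¹ ⋯ dxᵐ` on the domain of the chart `φ`. -/
def chartVolume (φ : OpenPartialHomeomorph M (EuclideanHalfSpace m)) : Measure M :=
  ((volume.restrict (φ.extend (𝓡∂ m)).target).withDensity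
    fun u ↦ ENNReal.ofReal (volumeDensity φ u)).map (φ.extend (𝓡∂ m)).symm

variable (m M) in
/-- The Riemannian volume measure: the smallest measure that is at least
`√(det g_ij) dx¹ ⋯ dxᵐ` on each chart domain of the maximal smooth atlas. -/
def riemannianVolume : Measure M :=
  ⨆ φ ∈ IsManifold.maximalAtlas (𝓡∂ m) ∞ M, chartVolume φ

variable [BorelSpace M]

local notation "𝔼" => EuclideanSpace ℝ (Fin m)

lemma measurableSet_extend_target (φ : OpenPartialHomeomorph M (EuclideanHalfSpace m)) :
    MeasurableSet (φ.extend (𝓡∂ m)).target := by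
  rw [φ.extend_target]
  exact (φ.open_target.preimage (𝓡∂ m).continuous_symm).measurableSet.inter
    (𝓡∂ m).isClosed_range.measurableSet

lemma aemeasurable_extend_symm (φ : OpenPartialHomeomorph M (EuclideanHalfSpace m)) :
    AEMeasurable (φ.extend (𝓡∂ m)).symm
      ((volume.restrict (φ.extend (𝓡∂ m)).target).withDensity
        fun u ↦ ENNReal.ofReal (volumeDensity φ u)) :=
  AEMeasurable.mono_ac
    (φ.continuousOn_extend_symm.aemeasurable (measurableSet_extend_target φ))
    (withDensity_absolutelyContinuous _ _)

lemma chartVolume_apply (φ : OpenPartialHomeomorph M (EuclideanHalfSpace m)) {A : Set M}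
    (hA : MeasurableSet A) :
    chartVolume φ A = ∫⁻ u in (φ.extend (𝓡∂ m)).symm ⁻¹' A ∩ (φ.extend (𝓡∂ m)).target,
      ENNReal.ofReal (volumeDensity φ u) := by
  rw [chartVolume, Measure.map_apply_of_aemeasurable (aemeasurable_extend_symm φ) hA,
    withDensity_apply', Measure.restrict_restrict' (measurableSet_extend_target φ)]

lemma measurableSet_preimage_extend_symm (φ : OpenPartialHomeomorph M (EuclideanHalfSpace m))
    {A : Set M} (hA : MeasurableSet A) :
    MeasurableSet ((φ.extend (𝓡∂ m)).symm ⁻¹' A ∩ (φ.extend (𝓡∂ m)).target) := by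
  have h := (continuousOn_iff_continuous_domRestrict.1
    (φ.continuousOn_extend_symm (I := 𝓡∂ m))).measurable hA
  have := (measurableSet_extend_target φ).subtype_image h
  convert this using 1
  ext u
  simp [and_comm]

instance (x : M) : FiniteDimensional ℝ (TangentSpace (𝓡∂ m) x) :=
  inferInstanceAs (FiniteDimensional ℝ 𝔼)

lemma tangentJacobian_eq_normDet (x : M) (L : 𝔼 →L[ℝ] TangentSpace (𝓡∂ m) x) :
    tangentJacobian x L =
      LinearMap.normDet (𝕜 := ℝ) (V := TangentSpace (𝓡∂ m) x) L.toLinearMap := by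
  have h := LinearMap.normDet_sq_eq_det_gram (𝕜 := ℝ) (V := TangentSpace (𝓡∂ m) x) L.toLinearMap
    (EuclideanSpace.basisFun (Fin m) ℝ)
  simp only [EuclideanSpace.basisFun_apply] at h
  rw [tangentJacobian, ← Real.sqrt_sq (LinearMap.normDet_nonneg (𝕜 := ℝ)
    (V := TangentSpace (𝓡∂ m) x) L.toLinearMap)]
  congr 1
  exact h.symm

lemma tangentJacobian_comp (x : M) (L : 𝔼 →L[ℝ] TangentSpace (𝓡∂ m) x) (A : 𝔼 →L[ℝ] 𝔼) :
    tangentJacobian x (L.comp A) = |A.det| * tangentJacobian x L := by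
  rw [tangentJacobian_eq_normDet, tangentJacobian_eq_normDet, mul_comm, ContinuousLinearMap.det,
    ← LinearMap.normDet_eq_abs_det]
  exact LinearMap.normDet_comp_of_finrank_eq (𝕜 := ℝ) (W := TangentSpace (𝓡∂ m) x)
    A.toLinearMap L.toLinearMap rfl

lemma mem_extend_target {φ : OpenPartialHomeomorph M (EuclideanHalfSpace m)} {x : M}
    (hx : x ∈ φ.source) : φ.extend (𝓡∂ m) x ∈ (φ.extend (𝓡∂ m)).target :=
  (φ.extend (𝓡∂ m)).map_source (by simpa using hx)

lemma mdifferentiableWithinAt_extend_symm [IsManifold (𝓡∂ m) ∞ M]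
    {φ : OpenPartialHomeomorph M (EuclideanHalfSpace m)}
    (hφ : φ ∈ IsManifold.maximalAtlas (𝓡∂ m) ∞ M) {u : 𝔼} (hu : u ∈ (φ.extend (𝓡∂ m)).target) :
    MDifferentiableWithinAt 𝓘(ℝ, 𝔼) (𝓡∂ m) (φ.extend (𝓡∂ m)).symm (range (𝓡∂ m)) u := by
  have h := contMDiffOn_extend_symm (I := 𝓡∂ m) hφ
  rw [(𝓡∂ m).image_eq, ← φ.extend_target] at h
  have h1 := (h u hu).mdifferentiableWithinAt (by simp)
  refine h1.mono_of_mem_nhdsWithin ?_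
  have := φ.extend_target_mem_nhdsWithin (I := 𝓡∂ m) (y := (φ.extend (𝓡∂ m)).symm u)
    (by simpa using (φ.extend (𝓡∂ m)).map_target hu)
  rwa [(φ.extend (𝓡∂ m)).right_inv hu] at this

lemma volumeDensity_change [IsManifold (𝓡∂ m) ∞ M]
    {φ ψ : OpenPartialHomeomorph M (EuclideanHalfSpace m)}
    (hφ : φ ∈ IsManifold.maximalAtlas (𝓡∂ m) ∞ M) (hψ : ψ ∈ IsManifold.maximalAtlas (𝓡∂ m) ∞ M)
    {x : M} (hxφ : x ∈ φ.source) (hxψ : x ∈ ψ.source) :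
    ∃ A : 𝔼 →L[ℝ] 𝔼, HasFDerivWithinAt (ψ.extend (𝓡∂ m) ∘ (φ.extend (𝓡∂ m)).symm) A
        (range (𝓡∂ m)) (φ.extend (𝓡∂ m) x) ∧
      volumeDensity φ (φ.extend (𝓡∂ m) x) = |A.det| * volumeDensity ψ (ψ.extend (𝓡∂ m) x) := by
  have hd : MDifferentiableWithinAt 𝓘(ℝ, 𝔼) (𝓡∂ m) (φ.extend (𝓡∂ m)).symm (range (𝓡∂ m))
      (φ.extend (𝓡∂ m) x) :=
    mdifferentiableWithinAt_extend_symm hφ (mem_extend_target hxφ)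
  have hd' : MDifferentiableWithinAt 𝓘(ℝ, 𝔼) (𝓡∂ m) (ψ.extend (𝓡∂ m)).symm (range (𝓡∂ m))
      (ψ.extend (𝓡∂ m) x) :=
    mdifferentiableWithinAt_extend_symm hψ (mem_extend_target hxψ)
  have hinvφ : (φ.extend (𝓡∂ m)).symm (φ.extend (𝓡∂ m) x) = x := φ.extend_left_inv hxφ
  have hinvψ : (ψ.extend (𝓡∂ m)).symm (ψ.extend (𝓡∂ m) x) = x := ψ.extend_left_inv hxψ
  have hτ : DifferentiableWithinAt ℝ (ψ.extend (𝓡∂ m) ∘ (φ.extend (𝓡∂ m)).symm)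
      (range (𝓡∂ m)) (φ.extend (𝓡∂ m) x) := by
    refine MDifferentiableWithinAt.differentiableWithinAt ?_
    refine MDifferentiableAt.comp_mdifferentiableWithinAt (I' := 𝓡∂ m) _ ?_ hd
    rw [hinvφ]
    exact (ψ.contMDiffAt_extend hψ hxψ).mdifferentiableAt (by simp)
  refine ⟨_, hτ.hasFDerivWithinAt, ?_⟩
  set A := fderivWithin ℝ (ψ.extend (𝓡∂ m) ∘ (φ.extend (𝓡∂ m)).symm) (range (𝓡∂ m))
    (φ.extend (𝓡∂ m) x) with hA
  have hu : UniqueMDiffWithinAt 𝓘(ℝ, 𝔼) (range (𝓡∂ m)) (φ.extend (𝓡∂ m) x) :=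
    ((𝓡∂ m).uniqueDiffOn _ (mem_range_self _)).uniqueMDiffWithinAt
  have key : HasMFDerivWithinAt 𝓘(ℝ, 𝔼) (𝓡∂ m) (φ.extend (𝓡∂ m)).symm (range (𝓡∂ m))
      (φ.extend (𝓡∂ m) x)
      ((mfderivWithin 𝓘(ℝ, 𝔼) (𝓡∂ m) (ψ.extend (𝓡∂ m)).symm (range (𝓡∂ m))
        (ψ.extend (𝓡∂ m) x) : 𝔼 →L[ℝ] 𝔼).comp A) := by
    have h1 : HasMFDerivWithinAt 𝓘(ℝ, 𝔼) 𝓘(ℝ, 𝔼)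
        (ψ.extend (𝓡∂ m) ∘ (φ.extend (𝓡∂ m)).symm) (range (𝓡∂ m)) (φ.extend (𝓡∂ m) x) A :=
      hτ.hasFDerivWithinAt.hasMFDerivWithinAt
    have hpt : (ψ.extend (𝓡∂ m) ∘ (φ.extend (𝓡∂ m)).symm) (φ.extend (𝓡∂ m) x) =
      ψ.extend (𝓡∂ m) x := by simp only [Function.comp_apply, hinvφ]
    have h2 := hd'.hasMFDerivWithinAt
    rw [← hpt] at h2
    have h3 := HasMFDerivWithinAt.comp (φ.extend (𝓡∂ m) x) h2 h1 (by
      intro u _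
      simp [OpenPartialHomeomorph.extend])
    rw [hpt] at h3
    refine h3.congr_of_eventuallyEq ?_ ?_
    · have h4 : (φ.extend (𝓡∂ m)).symm ⁻¹' ψ.source ∈ 𝓝[range (𝓡∂ m)] (φ.extend (𝓡∂ m) x) := by
        apply hd.continuousWithinAt.preimage_mem_nhdsWithin
        rw [hinvφ]
        exact ψ.open_source.mem_nhds hxψ
      filter_upwards [h4] with u hu
      simp only [Function.comp_apply]
      rw [ψ.extend_left_inv hu]
    · simp only [Function.comp_apply, hinvφ, hinvψ]
  rw [volumeDensity, volumeDensity, key.mfderivWithin hu, hinvφ, hinvψ]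
  exact tangentJacobian_comp x _ A

lemma chartVolume_eq [IsManifold (𝓡∂ m) ∞ M]
    {φ ψ : OpenPartialHomeomorph M (EuclideanHalfSpace m)}
    (hφ : φ ∈ IsManifold.maximalAtlas (𝓡∂ m) ∞ M) (hψ : ψ ∈ IsManifold.maximalAtlas (𝓡∂ m) ∞ M)
    {A : Set M} (hA : MeasurableSet A) (hAφ : A ⊆ φ.source) (hAψ : A ⊆ ψ.source) :
    chartVolume φ A = chartVolume ψ A := by
  set S := (φ.extend (𝓡∂ m)).symm ⁻¹' A ∩ (φ.extend (𝓡∂ m)).target with hS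
  have hSm : MeasurableSet S := measurableSet_preimage_extend_symm φ hA
  set τ : 𝔼 → 𝔼 := ψ.extend (𝓡∂ m) ∘ (φ.extend (𝓡∂ m)).symm with hτ
  have hrinv : ∀ u ∈ S, φ.extend (𝓡∂ m) ((φ.extend (𝓡∂ m)).symm u) = u := fun u hu ↦
    (φ.extend (𝓡∂ m)).right_inv hu.2
  have key : ∀ u, ∃ B : 𝔼 →L[ℝ] 𝔼, u ∈ S → HasFDerivWithinAt τ B S u ∧
      volumeDensity φ u = |B.det| * volumeDensity ψ (τ u) := by
    intro u
    by_cases hu : u ∈ S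
    · obtain ⟨B, hB, hB'⟩ := volumeDensity_change hφ hψ (hAφ hu.1) (hAψ hu.1)
      rw [hrinv u hu] at hB hB'
      exact ⟨B, fun _ ↦ ⟨hB.mono fun v hv ↦ φ.extend_target_subset_range hv.2, hB'⟩⟩
    · exact ⟨0, fun h ↦ (hu h).elim⟩
  choose τ' hτ' using key
  have himg : τ '' S = (ψ.extend (𝓡∂ m)).symm ⁻¹' A ∩ (ψ.extend (𝓡∂ m)).target := by
    ext v
    constructor
    · rintro ⟨u, hu, rfl⟩
      have := hAψ hu.1
      refine ⟨?_, mem_extend_target this⟩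
      simp only [hτ, mem_preimage, Function.comp_apply]
      rw [ψ.extend_left_inv this]
      exact hu.1
    · rintro ⟨hv, hvt⟩
      have hv' := hAφ hv
      refine ⟨φ.extend (𝓡∂ m) ((ψ.extend (𝓡∂ m)).symm v), ⟨?_, mem_extend_target hv'⟩, ?_⟩
      · simp only [mem_preimage]
        rw [φ.extend_left_inv hv']
        exact hv
      · simp only [hτ, Function.comp_apply]
        rw [φ.extend_left_inv hv', (ψ.extend (𝓡∂ m)).right_inv hvt]
  have hinj : InjOn τ S := by
    intro u hu v hv huv
    simp only [hτ, Function.comp_apply] at huv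
    have h1 := congrArg (ψ.extend (𝓡∂ m)).symm huv
    rw [ψ.extend_left_inv (hAψ hu.1), ψ.extend_left_inv (hAψ hv.1)] at h1
    rw [← hrinv u hu, ← hrinv v hv, h1]
  rw [chartVolume_apply φ hA, chartVolume_apply ψ hA, ← himg,
    lintegral_image_eq_lintegral_abs_det_fderiv_mul volume hSm (fun u hu ↦ (hτ' u hu).1) hinj]
  refine setLIntegral_congr_fun hSm fun u hu ↦ ?_
  rw [(hτ' u hu).2, ENNReal.ofReal_mul (abs_nonneg _)]

lemma chartVolume_compl_source (φ : OpenPartialHomeomorph M (EuclideanHalfSpace m)) :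
    chartVolume φ φ.sourceᶜ = 0 := by
  rw [chartVolume_apply φ φ.open_source.measurableSet.compl]
  have : (φ.extend (𝓡∂ m)).symm ⁻¹' φ.sourceᶜ ∩ (φ.extend (𝓡∂ m)).target = ∅ := by
    ext u
    simp only [mem_inter_iff, mem_preimage, mem_compl_iff, mem_empty_iff_false, iff_false, not_and]
    intro h h'
    exact h (by simpa using (φ.extend (𝓡∂ m)).map_target h')
  rw [this]
  simp

/-- On the domain of a chart, the Riemannian volume measure is `√(det g_ij) dx¹ ⋯ dxᵐ`. -/
theorem riemannianVolume_restrict [IsManifold (𝓡∂ m) ∞ M]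
    {φ : OpenPartialHomeomorph M (EuclideanHalfSpace m)}
    (hφ : φ ∈ IsManifold.maximalAtlas (𝓡∂ m) ∞ M) :
    (riemannianVolume m M).restrict φ.source = chartVolume φ := by
  have hs := φ.open_source.measurableSet
  have hself : (chartVolume φ).restrict φ.source = chartVolume φ :=
    Measure.restrict_eq_self_of_ae_mem (by
      rw [ae_iff]; exact chartVolume_compl_source φ)
  apply le_antisymm
  · have h : riemannianVolume m M ≤
        chartVolume φ + (riemannianVolume m M).restrict φ.sourceᶜ := by
      refine iSup₂_le fun ψ hψ ↦ ?_
      have hle : chartVolume ψ ≤ riemannianVolume m M :=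
        le_iSup₂ (f := fun (φ : OpenPartialHomeomorph M (EuclideanHalfSpace m))
          (_ : φ ∈ IsManifold.maximalAtlas (𝓡∂ m) ∞ M) ↦ chartVolume φ) ψ hψ
      rw [← Measure.restrict_add_restrict_compl (μ := chartVolume ψ) hs]
      refine add_le_add ?_ (Measure.restrict_mono le_rfl hle)
      refine Measure.le_intro fun A hA _ ↦ ?_
      rw [Measure.restrict_apply hA]
      have h0 : chartVolume ψ (A ∩ φ.source) = chartVolume ψ (A ∩ φ.source ∩ ψ.source) := by
        refine (measure_inter_conull ?_).symm
        exact chartVolume_compl_source ψ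
      rw [h0, chartVolume_eq hψ hφ ((hA.inter hs).inter ψ.open_source.measurableSet)
        (fun x hx ↦ hx.2) (fun x hx ↦ hx.1.2)]
      exact measure_mono fun x hx ↦ hx.1.1
    calc (riemannianVolume m M).restrict φ.source
        ≤ (chartVolume φ + (riemannianVolume m M).restrict φ.sourceᶜ).restrict φ.source :=
          Measure.restrict_mono le_rfl h
      _ = chartVolume φ := by
          rw [Measure.restrict_add, hself, Measure.restrict_restrict hs, inter_compl_self,
            Measure.restrict_empty, add_zero]
  · calc chartVolume φ = (chartVolume φ).restrict φ.source := hself.symm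
      _ ≤ _ := Measure.restrict_mono le_rfl
        (le_iSup₂ (f := fun (φ : OpenPartialHomeomorph M (EuclideanHalfSpace m))
          (_ : φ ∈ IsManifold.maximalAtlas (𝓡∂ m) ∞ M) ↦ chartVolume φ) φ hφ)

lemma isContinuousRiemannianBundle_tangent [IsManifold (𝓡∂ m) ∞ M]
    [IsContMDiffRiemannianBundle (𝓡∂ m) ∞ 𝔼 (fun x : M ↦ TangentSpace (𝓡∂ m) x)] :
    IsContinuousRiemannianBundle 𝔼 (fun x : M ↦ TangentSpace (𝓡∂ m) x) := by
  obtain ⟨g, hg, hg'⟩ := IsContMDiffRiemannianBundle.exists_contMDiff (IB := 𝓡∂ m) (n := ∞)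
    (F := 𝔼) (E := fun x : M ↦ TangentSpace (𝓡∂ m) x)
  exact ⟨g, hg.continuous, hg'⟩

lemma tangentJacobian_le (x : M) (L : 𝔼 →L[ℝ] TangentSpace (𝓡∂ m) x) {C : ℝ} (hC : ‖L‖ ≤ C) :
    tangentJacobian x L ≤ √(m.factorial * (C ^ 2) ^ m) := by
  have hC0 : 0 ≤ C := (ContinuousLinearMap.opNorm_nonneg L).trans hC
  refine Real.sqrt_le_sqrt ((le_abs_self _).trans ?_)
  have hb : ∀ i : Fin m, ‖L (EuclideanSpace.single i (1 : ℝ))‖ ≤ C := fun i ↦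
    (L.le_of_opNorm_le hC _).trans (by simp)
  have := Matrix.det_le (abv := (IsAbsoluteValue.toAbsoluteValue (abs : ℝ → ℝ)))
    (A := Matrix.gram (E := TangentSpace (𝓡∂ m) x) ℝ fun i : Fin m ↦
      L (EuclideanSpace.single i (1 : ℝ))) (x := C ^ 2) (by
    intro i j
    rw [Matrix.gram_apply, sq]
    refine (abs_real_inner_le_norm _ _).trans ?_
    exact mul_le_mul (hb i) (hb j) (norm_nonneg _) hC0)
  simpa [nsmul_eq_mul] using this

instance [IsManifold (𝓡∂ m) ∞ M]
    [IsContMDiffRiemannianBundle (𝓡∂ m) ∞ 𝔼 (fun x : M ↦ TangentSpace (𝓡∂ m) x)] :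
    IsLocallyFiniteMeasure (riemannianVolume m M) where
  finiteAtNhds x := by
    have := isContinuousRiemannianBundle_tangent (M := M) (m := m)
    obtain ⟨C, -, hC⟩ := eventually_norm_mfderivWithin_symm_extChartAt_lt (𝓡∂ m) x
    set φ := chartAt (EuclideanHalfSpace m) x with hφ
    have hmem : φ ∈ IsManifold.maximalAtlas (𝓡∂ m) ∞ M := IsManifold.chart_mem_maximalAtlas x
    obtain ⟨ε, hε, hball⟩ := Metric.mem_nhdsWithin_iff.1 hC
    have hcont : ContinuousAt (φ.extend (𝓡∂ m)) x :=
      φ.continuousAt_extend (mem_chart_source _ x)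
    obtain ⟨N, hN, hNopen, hxN⟩ := mem_nhds_iff.1 (inter_mem
      (hcont.preimage_mem_nhds (Metric.ball_mem_nhds (φ.extend (𝓡∂ m) x) hε))
      (φ.open_source.mem_nhds (mem_chart_source _ x)))
    refine ⟨N, hNopen.mem_nhds hxN, ?_⟩
    have h1 : riemannianVolume m M N = chartVolume φ N := by
      rw [← riemannianVolume_restrict hmem, Measure.restrict_apply hNopen.measurableSet,
        inter_eq_left.2 fun y hy ↦ (hN hy).2]
    rw [h1, chartVolume_apply φ hNopen.measurableSet]
    have hsub : (φ.extend (𝓡∂ m)).symm ⁻¹' N ∩ (φ.extend (𝓡∂ m)).target ⊆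
        Metric.ball (φ.extend (𝓡∂ m) x) ε ∩ range (𝓡∂ m) := fun u hu ↦ by
      refine ⟨?_, φ.extend_target_subset_range hu.2⟩
      have := (hN hu.1).1
      rwa [mem_preimage, (φ.extend (𝓡∂ m)).right_inv hu.2] at this
    refine (setLIntegral_mono' (g := fun _ ↦ ENNReal.ofReal (√(m.factorial * (C ^ 2) ^ m)))
      (measurableSet_preimage_extend_symm φ hNopen.measurableSet) fun u hu ↦ ?_).trans_lt ?_
    · exact ENNReal.ofReal_le_ofReal (tangentJacobian_le _ _ (le_of_lt (hball (hsub hu))))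
    · rw [setLIntegral_const]
      refine ENNReal.mul_lt_top ENNReal.ofReal_lt_top ?_
      exact (measure_mono fun u hu ↦ (hsub hu).1).trans_lt Metric.isBounded_ball.measure_lt_top

lemma continuousOn_volumeDensity [IsManifold (𝓡∂ m) ∞ M]
    [IsContMDiffRiemannianBundle (𝓡∂ m) ∞ 𝔼 (fun x : M ↦ TangentSpace (𝓡∂ m) x)]
    {φ : OpenPartialHomeomorph M (EuclideanHalfSpace m)}
    (hφ : φ ∈ IsManifold.maximalAtlas (𝓡∂ m) ∞ M) :
    ContinuousOn (volumeDensity φ) (φ.extend (𝓡∂ m)).target := by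
  have := isContinuousRiemannianBundle_tangent (M := M) (m := m)
  have ht : (φ.extend (𝓡∂ m)).target = range (𝓡∂ m) ∩ (𝓡∂ m).symm ⁻¹' φ.target := by
    rw [φ.extend_target, inter_comm]
  have hopen : IsOpen ((𝓡∂ m).symm ⁻¹' φ.target) := φ.open_target.preimage (𝓡∂ m).continuous_symm
  have hsm := contMDiffOn_extend_symm (I := 𝓡∂ m) hφ
  rw [(𝓡∂ m).image_eq, ← φ.extend_target] at hsm
  have hu : UniqueMDiffOn 𝓘(ℝ, 𝔼) (φ.extend (𝓡∂ m)).target := by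
    rw [ht]
    exact ((𝓡∂ m).uniqueDiffOn.inter hopen).uniqueMDiffOn
  have hT := hsm.continuousOn_tangentMapWithin (by norm_num) hu
  have hcol : ∀ i : Fin m, ContinuousOn (fun u : 𝔼 ↦
      (⟨(φ.extend (𝓡∂ m)).symm u, mfderivWithin 𝓘(ℝ, 𝔼) (𝓡∂ m) (φ.extend (𝓡∂ m)).symm
        (range (𝓡∂ m)) u (EuclideanSpace.single i (1 : ℝ) : 𝔼)⟩ : TangentBundle (𝓡∂ m) M))
      (φ.extend (𝓡∂ m)).target := by
    intro i
    have hsec : Continuous (fun u : 𝔼 ↦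
        (⟨u, (EuclideanSpace.single i (1 : ℝ) : 𝔼)⟩ : TangentBundle 𝓘(ℝ, 𝔼) 𝔼)) := by
      exact ((contMDiff_vectorSpace_iff_contDiff (n := 0)
        (V := fun _ : 𝔼 ↦ (EuclideanSpace.single i (1 : ℝ) : 𝔼))).2 contDiff_const).continuous
    refine (hT.comp hsec.continuousOn (fun u hu ↦ hu)).congr fun u hu ↦ ?_
    simp only [Function.comp_apply, tangentMapWithin]
    rw [ht, mfderivWithin_inter (hopen.mem_nhds (ht ▸ hu).2)]
  refine Real.continuous_sqrt.comp_continuousOn ?_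
  simp only [Matrix.det_apply]
  refine continuousOn_finsetSum _ fun σ _ ↦ ContinuousOn.const_smul
    (continuousOn_finsetProd _ fun i _ ↦ ?_) _
  exact (hcol (σ i)).inner_bundle (hcol i)

lemma tangentJacobian_pos (x : M) (L : 𝔼 →L[ℝ] TangentSpace (𝓡∂ m) x)
    (hL : Function.Injective L) : 0 < tangentJacobian x L := by
  rw [tangentJacobian_eq_normDet]
  refine (LinearMap.normDet_nonneg _).lt_of_ne' ?_
  rw [Ne, LinearMap.normDet_eq_zero_iff_ker_ne_bot, not_not]
  exact LinearMap.ker_eq_bot.2 hL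

instance [IsManifold (𝓡∂ m) ∞ M]
    [IsContMDiffRiemannianBundle (𝓡∂ m) ∞ 𝔼 (fun x : M ↦ TangentSpace (𝓡∂ m) x)] :
    (riemannianVolume m M).IsOpenPosMeasure where
  open_pos U hU hne := by
    obtain ⟨x, hx⟩ := hne
    set φ := chartAt (EuclideanHalfSpace m) x with hφ
    have hmem : φ ∈ IsManifold.maximalAtlas (𝓡∂ m) ∞ M := IsManifold.chart_mem_maximalAtlas x
    set N := U ∩ φ.source with hN
    have hNo : IsOpen N := hU.inter φ.open_source
    have h1 : riemannianVolume m M N = chartVolume φ N := by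
      rw [← riemannianVolume_restrict hmem, Measure.restrict_apply hNo.measurableSet,
        inter_eq_left.2 fun y hy ↦ hy.2]
    have hle : riemannianVolume m M N ≤ riemannianVolume m M U := measure_mono fun y hy ↦ hy.1
    refine fun h0 ↦ ?_
    have h2 : chartVolume φ N = 0 := by rw [← h1]; exact le_antisymm (hle.trans h0.le) zero_le
    rw [chartVolume_apply φ hNo.measurableSet] at h2
    set S := (φ.extend (𝓡∂ m)).symm ⁻¹' N ∩ (φ.extend (𝓡∂ m)).target with hS
    have hSm : MeasurableSet S := measurableSet_preimage_extend_symm φ hNo.measurableSet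
    have hpos : ∀ u ∈ S, 0 < ENNReal.ofReal (volumeDensity φ u) := fun u hu ↦ by
      rw [ENNReal.ofReal_pos]
      exact tangentJacobian_pos _ _ (isInvertible_mfderivWithin_extChartAt_symm hu.2).injective
    have hmeas : AEMeasurable (fun u ↦ ENNReal.ofReal (volumeDensity φ u)) (volume.restrict S) :=
      ((continuousOn_volumeDensity hmem).mono fun u hu ↦ hu.2).aemeasurable hSm |>.ennreal_ofReal
    have hS0 : volume S = 0 := by
      rw [lintegral_eq_zero_iff' hmeas, EventuallyEq, ae_restrict_iff' hSm, ae_iff] at h2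
      refine measure_mono_null (fun u hu ↦ ?_) h2
      simp only [mem_ofPred_eq, Classical.not_imp]
      exact ⟨hu, (hpos u hu).ne'⟩
    obtain ⟨O, hO, hOS⟩ : ∃ O : Set 𝔼, IsOpen O ∧ S = O ∩ range (𝓡∂ m) := by
      have h3 : IsOpen (φ.symm ⁻¹' N ∩ φ.target) := by
        rw [inter_comm]; exact φ.isOpen_inter_preimage_symm hNo
      refine ⟨(𝓡∂ m).symm ⁻¹' (φ.symm ⁻¹' N ∩ φ.target), h3.preimage (𝓡∂ m).continuous_symm, ?_⟩
      rw [hS, φ.extend_target]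
      ext u
      simp [OpenPartialHomeomorph.extend, and_assoc]
    have hxS : φ.extend (𝓡∂ m) x ∈ S := by
      have hxs : x ∈ φ.source := mem_chart_source _ x
      refine ⟨?_, mem_extend_target hxs⟩
      rw [mem_preimage, φ.extend_left_inv hxs]
      exact ⟨hx, hxs⟩
    rw [hOS] at hxS
    obtain ⟨v, hvO, hvi⟩ := mem_closure_iff.1
      ((𝓡∂ m).range_subset_closure_interior hxS.2) O hO hxS.1
    have hop : IsOpen (O ∩ interior (range (𝓡∂ m))) := hO.inter isOpen_interior
    refine (hop.measure_pos volume ⟨v, hvO, hvi⟩).ne' (measure_mono_null ?_ hS0)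
    rw [hOS]
    exact inter_subset_inter_right _ interior_subset

end Volume
noncomputable section Sections

variable {m : ℕ} [NeZero m] {𝔽 : Type*} [RCLike 𝔽]
  {M₁ : Type*} [TopologicalSpace M₁] [ChartedSpace (EuclideanHalfSpace m) M₁]
  {M₂ : Type*} [TopologicalSpace M₂] [ChartedSpace (EuclideanHalfSpace m) M₂]
  {F : Type*} [NormedAddCommGroup F] [NormedSpace 𝔽 F] [NormedSpace ℝ F] [IsScalarTower ℝ 𝔽 F]
  {V : M₁ → Type*} [TopologicalSpace (TotalSpace F V)] [∀ x, NormedAddCommGroup (V x)]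
  [∀ x, InnerProductSpace 𝔽 (V x)] [∀ x, InnerProductSpace ℝ (V x)]
  [FiberBundle F V] [VectorBundle ℝ F V] [VectorBundle 𝔽 F V]

lemma contMDiffAt_lift_add {f : M₂ → M₁} {s t : Π y, V (f y)} {y : M₂}
    (hs : ContMDiffAt (𝓡∂ m) ((𝓡∂ m).prod 𝓘(ℝ, F)) ∞
      (fun y ↦ (⟨f y, s y⟩ : TotalSpace F V)) y)
    (ht : ContMDiffAt (𝓡∂ m) ((𝓡∂ m).prod 𝓘(ℝ, F)) ∞
      (fun y ↦ (⟨f y, t y⟩ : TotalSpace F V)) y) :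
    ContMDiffAt (𝓡∂ m) ((𝓡∂ m).prod 𝓘(ℝ, F)) ∞
      (fun y ↦ (⟨f y, s y + t y⟩ : TotalSpace F V)) y := by
  rw [contMDiffAt_totalSpace] at hs ht ⊢
  refine ⟨hs.1, (hs.2.add ht.2).congr_of_eventuallyEq ?_⟩
  have hb := hs.1.continuousAt.preimage_mem_nhds
    ((trivializationAt F V (f y)).open_baseSet.mem_nhds (mem_baseSet_trivializationAt F V (f y)))
  filter_upwards [hb] with w hw
  exact ((trivializationAt F V (f y)).linear ℝ hw).map_add _ _

lemma contMDiffAt_lift_smul {f : M₂ → M₁} {s : Π y, V (f y)} {y : M₂} (c : 𝔽)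
    (hs : ContMDiffAt (𝓡∂ m) ((𝓡∂ m).prod 𝓘(ℝ, F)) ∞
      (fun y ↦ (⟨f y, s y⟩ : TotalSpace F V)) y) :
    ContMDiffAt (𝓡∂ m) ((𝓡∂ m).prod 𝓘(ℝ, F)) ∞
      (fun y ↦ (⟨f y, c • s y⟩ : TotalSpace F V)) y := by
  rw [contMDiffAt_totalSpace] at hs ⊢
  refine ⟨hs.1, ?_⟩
  have h : ContMDiff 𝓘(ℝ, F) 𝓘(ℝ, F) ∞ (fun v : F ↦ c • v) :=
    (ContinuousLinearMap.restrictScalars ℝ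
      (c • ContinuousLinearMap.id 𝔽 F)).contDiff.contMDiff
  refine (h.contMDiffAt.comp y hs.2).congr_of_eventuallyEq ?_
  have hb := hs.1.continuousAt.preimage_mem_nhds
    ((trivializationAt F V (f y)).open_baseSet.mem_nhds (mem_baseSet_trivializationAt F V (f y)))
  filter_upwards [hb] with w hw
  exact ((trivializationAt F V (f y)).linear 𝔽 hw).map_smul _ _

lemma contMDiffAt_lift_zero {f : M₂ → M₁} {y : M₂} (hf : ContMDiffAt (𝓡∂ m) (𝓡∂ m) ∞ f y) :
    ContMDiffAt (𝓡∂ m) ((𝓡∂ m).prod 𝓘(ℝ, F)) ∞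
      (fun y ↦ (⟨f y, 0⟩ : TotalSpace F V)) y :=
  (contMDiff_zeroSection ℝ V).contMDiffAt.comp y hf

variable (𝔽 m F V) in
/-- The space `Γ(E₁)` of smooth sections of a vector bundle over a manifold with boundary. -/
def smoothSections : Submodule 𝔽 (Π x, V x) where
  carrier := {σ | ContMDiff (𝓡∂ m) ((𝓡∂ m).prod 𝓘(ℝ, F)) ∞
    (fun x ↦ (⟨x, σ x⟩ : TotalSpace F V))}
  add_mem' hσ hτ x := contMDiffAt_lift_add (f := fun x ↦ x) (hσ x) (hτ x)
  zero_mem' _ := contMDiffAt_lift_zero contMDiffAt_id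
  smul_mem' c _ hσ x := contMDiffAt_lift_smul (f := fun x ↦ x) c (hσ x)

variable (p : C^∞⟮𝓡∂ m, M₂; 𝓡∂ m, M₁⟯)

lemma contMDiffAt_pullback_iff {η : Π z, V (p z)} {z : M₂} :
    ContMDiffAt (𝓡∂ m) ((𝓡∂ m).prod 𝓘(ℝ, F)) ∞
      (fun z ↦ (⟨z, η z⟩ : TotalSpace F (p *ᵖ V))) z ↔
    ContMDiffAt (𝓡∂ m) ((𝓡∂ m).prod 𝓘(ℝ, F)) ∞
      (fun z ↦ (⟨p z, η z⟩ : TotalSpace F V)) z := by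
  rw [contMDiffAt_totalSpace, contMDiffAt_totalSpace]
  exact ⟨fun h ↦ ⟨p.contMDiff.contMDiffAt, h.2⟩, fun h ↦ ⟨contMDiffAt_id, h.2⟩⟩

variable (𝔽 F V) in
/-- The space `Γ(E₂)` of smooth sections of the pullback bundle `E₂ = p^* E₁`. -/
def pullbackSections : Submodule 𝔽 (Π z, V (p z)) where
  carrier := {η | ContMDiff (𝓡∂ m) ((𝓡∂ m).prod 𝓘(ℝ, F)) ∞
    (fun z ↦ (⟨z, η z⟩ : TotalSpace F (p *ᵖ V)))}
  add_mem' hη hθ z := (contMDiffAt_pullback_iff p).2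
    (contMDiffAt_lift_add ((contMDiffAt_pullback_iff p).1 (hη z))
      ((contMDiffAt_pullback_iff p).1 (hθ z)))
  zero_mem' _ := (contMDiffAt_pullback_iff p).2 (contMDiffAt_lift_zero p.contMDiff.contMDiffAt)
  smul_mem' c _ hη z := (contMDiffAt_pullback_iff p).2
    (contMDiffAt_lift_smul c ((contMDiffAt_pullback_iff p).1 (hη z)))

lemma pullbackSections_contMDiff {η : Π z, V (p z)} (hη : η ∈ pullbackSections 𝔽 F V p) :
    ContMDiff (𝓡∂ m) ((𝓡∂ m).prod 𝓘(ℝ, F)) ∞ (fun z ↦ (⟨p z, η z⟩ : TotalSpace F V)) :=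
  fun z ↦ (contMDiffAt_pullback_iff p).1 (hη z)

variable {p} (hp : IsLocalDiffeomorph (𝓡∂ m) (𝓡∂ m) ∞ p)

open Classical in
/-- The local push-forward of a section `η` of `p^* E₁` near `z`: the section
`x ↦ η (s x)` of `E₁`, where `s` is the local inverse of `p` with `s (p z) = z`
(and zero away from `p z`). -/
def descend (z : M₂) (η : Π w, V (p w)) : Π x, V x := fun x ↦
  if h : p ((hp z).localInverse x) = x then h ▸ η ((hp z).localInverse x) else 0

lemma descend_eventually (z : M₂) (η : Π w, V (p w)) :
    ∀ᶠ w in 𝓝 z, descend hp z η (p w) = η w := by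
  filter_upwards [(hp z).localInverse_eventuallyEq_left] with w hw
  have hw : (hp z).localInverse (p w) = w := hw
  have h : p ((hp z).localInverse (p w)) = p w := by rw [hw]
  have aux : ∀ (w' : M₂) (h' : w' = w) (h : p w' = p w), (h ▸ η w' : V (p w)) = η w := by
    rintro _ rfl _; rfl
  rw [descend, dif_pos h]
  exact aux _ hw h

lemma descend_totalSpace (z : M₂) (η : Π w, V (p w)) {x : M₁}
    (hx : x ∈ (hp z).localInverse.source) :
    (⟨x, descend hp z η x⟩ : TotalSpace F V) =
      ⟨p ((hp z).localInverse x), η ((hp z).localInverse x)⟩ := by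
  have h := (hp z).localInverse_right_inv hx
  have aux : ∀ (x' : M₁) (h : x' = x) (v : V x'), (⟨x, h ▸ v⟩ : TotalSpace F V) = ⟨x', v⟩ := by
    rintro _ rfl _; rfl
  rw [descend, dif_pos h]
  exact aux _ h _

lemma descend_add (z : M₂) (η θ : Π w, V (p w)) :
    descend hp z (η + θ) = descend hp z η + descend hp z θ := by
  funext x
  have aux : ∀ (x' : M₁) (h : x' = x) (v w : V x'),
      (h ▸ (v + w) : V x) = (h ▸ v : V x) + (h ▸ w : V x) := by
    rintro _ rfl _ _; rfl
  by_cases h : p ((hp z).localInverse x) = x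
  · simp only [descend, Pi.add_apply, dif_pos h]
    exact aux _ h _ _
  · simp [descend, dif_neg h]

lemma descend_smul (z : M₂) (c : 𝔽) (η : Π w, V (p w)) :
    descend hp z (c • η) = c • descend hp z η := by
  funext x
  have aux : ∀ (x' : M₁) (h : x' = x) (v : V x'), (h ▸ (c • v) : V x) = c • (h ▸ v : V x) := by
    rintro _ rfl _; rfl
  by_cases h : p ((hp z).localInverse x) = x
  · simp only [descend, Pi.smul_apply, dif_pos h]
    exact aux _ h _
  · simp [descend, dif_neg h]

lemma descend_contMDiffOn (z : M₂) {η : Π w, V (p w)} (hη : η ∈ pullbackSections 𝔽 F V p) :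
    ContMDiffOn (𝓡∂ m) ((𝓡∂ m).prod 𝓘(ℝ, F)) ∞
      (fun x ↦ (⟨x, descend hp z η x⟩ : TotalSpace F V)) (hp z).localInverse.source :=
  ((pullbackSections_contMDiff p hη).comp_contMDiffOn (hp z).localInverse_contMDiffOn).congr
    fun _ hx ↦ descend_totalSpace hp z η hx

lemma exists_extension (hp : IsLocalDiffeomorph (𝓡∂ m) (𝓡∂ m) ∞ p) [T2Space M₁] [IsManifold (𝓡∂ m) ∞ M₁] (z : M₂)
    (η : pullbackSections 𝔽 F V p) :
    ∃ σ : smoothSections m 𝔽 F V, ∀ᶠ w in 𝓝 z, σ.1 (p w) = η.1 w := by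
  obtain ⟨χ, -, hχ⟩ := (SmoothBumpFunction.nhds_basis_tsupport (I := 𝓡∂ m) (p z)).mem_iff.1
    ((hp z).localInverse.open_source.mem_nhds (hp z).localInverse_mem_source)
  refine ⟨⟨fun x ↦ χ x • descend hp z η.1 x, ?_⟩, ?_⟩
  · exact ContMDiffOn.smul_section_of_tsupport χ.contMDiff.contMDiffOn
      (hp z).localInverse.open_source hχ (descend_contMDiffOn hp z η.2)
  · filter_upwards [descend_eventually hp z η.1,
      p.contMDiff.continuous.continuousAt.eventually χ.eventuallyEq_one] with w hw hw'
    simp only [hw']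
    rw [hw]
    simp

variable [IsManifold (𝓡∂ m) ∞ M₁]

variable (F) in
/-- The coordinate expression of a section near `x₀`, an `F`-valued function on coordinate space,
in the chart and the local trivialization at `x₀`. -/
def coordSection (x₀ : M₁) (σ : Π x, V x) :
    EuclideanSpace ℝ (Fin m) → F := fun u ↦
  (trivializationAt F V x₀ ⟨(extChartAt (𝓡∂ m) x₀).symm u, σ ((extChartAt (𝓡∂ m) x₀).symm u)⟩).2

variable (m 𝔽 F V) in
/-- A linear differential operator `D : Γ(E₁) → Γ(E₁)` of order at most `order`: in local
coordinates and trivializations, `D` is `∑_{|α| ≤ order} A^α ∂^α` with smooth matrix-valued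
coefficients. Partial derivatives of order `k` are indexed by the tuples `i : Fin k → Fin m`
of differentiated coordinates. -/
structure DifferentialOperator where
  toLinearMap : smoothSections m 𝔽 F V →ₗ[𝔽] smoothSections m 𝔽 F V
  order : ℕ
  local_expression : ∀ x₀ : M₁, ∃ A : (k : ℕ) → (Fin k → Fin m) → M₁ → (F →L[𝔽] F),
    (∀ k i, ContMDiffOn (𝓡∂ m) 𝓘(ℝ, F →L[𝔽] F) ∞ (A k i)
      ((chartAt (EuclideanHalfSpace m) x₀).source ∩ (trivializationAt F V x₀).baseSet)) ∧
    ∀ σ : smoothSections m 𝔽 F V,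
      ∀ x ∈ (chartAt (EuclideanHalfSpace m) x₀).source ∩ (trivializationAt F V x₀).baseSet,
        (trivializationAt F V x₀ ⟨x, (toLinearMap σ).1 x⟩).2 =
          ∑ k ∈ Finset.range (order + 1), ∑ i : Fin k → Fin m,
            A k i x (iteratedFDerivWithin ℝ k (coordSection F x₀ σ.1) (range (𝓡∂ m))
              (extChartAt (𝓡∂ m) x₀ x) fun j ↦ EuclideanSpace.single (i j) 1)

lemma DifferentialOperator.congr (D : DifferentialOperator m 𝔽 F V)
    {σ τ : smoothSections m 𝔽 F V} {x : M₁} (h : ∀ᶠ y in 𝓝 x, σ.1 y = τ.1 y) :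
    (D.toLinearMap σ).1 x = (D.toLinearMap τ).1 x := by
  obtain ⟨A, -, hA⟩ := D.local_expression x
  have hx : x ∈ (chartAt (EuclideanHalfSpace m) x).source ∩ (trivializationAt F V x).baseSet :=
    ⟨mem_chart_source _ x, mem_baseSet_trivializationAt F V x⟩
  have heq : coordSection F x σ.1 =ᶠ[𝓝[range (𝓡∂ m)] (extChartAt (𝓡∂ m) x x)]
      coordSection F x τ.1 := by
    have hc : ContinuousAt (extChartAt (𝓡∂ m) x).symm (extChartAt (𝓡∂ m) x x) :=
      continuousAt_extChartAt_symm x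
    have h' : ∀ᶠ u in 𝓝 (extChartAt (𝓡∂ m) x x), σ.1 ((extChartAt (𝓡∂ m) x).symm u) =
        τ.1 ((extChartAt (𝓡∂ m) x).symm u) := by
      refine hc.eventually (p := fun y ↦ σ.1 y = τ.1 y) ?_
      rwa [extChartAt_to_inv]
    refine nhdsWithin_le_nhds (h'.mono fun u hu ↦ ?_)
    simp only [coordSection, hu]
  have h1 : (trivializationAt F V x ⟨x, (D.toLinearMap σ).1 x⟩).2 =
      (trivializationAt F V x ⟨x, (D.toLinearMap τ).1 x⟩).2 := by
    rw [hA σ x hx, hA τ x hx]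
    refine Finset.sum_congr rfl fun k _ ↦ Finset.sum_congr rfl fun i _ ↦ ?_
    rw [heq.iteratedFDerivWithin_eq (heq.self_of_nhdsWithin (by simp [extChartAt]))]
  exact ((trivializationAt F V x).continuousLinearEquivAt ℝ x hx.2).injective h1

/-- The value at `z` of the lift of `D`: `(D₂ η)(z) = (D₁ σ)(p z)` for any section `σ` with
`η = p^* σ` near `z`. -/
def liftValue [T2Space M₁] (D : DifferentialOperator m 𝔽 F V) (η : pullbackSections 𝔽 F V p)
    (z : M₂) : V (p z) :=
  (D.toLinearMap (exists_extension hp z η).choose).1 (p z)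

lemma eventually_of_eventually_pullback (hp : IsLocalDiffeomorph (𝓡∂ m) (𝓡∂ m) ∞ p) {P : M₁ → Prop} {z : M₂} (h : ∀ᶠ w in 𝓝 z, P (p w)) :
    ∀ᶠ x in 𝓝 (p z), P x := by
  rw [← hp.isLocalHomeomorph.map_nhds_eq z]
  exact h

theorem liftValue_eq [T2Space M₁] (D : DifferentialOperator m 𝔽 F V)
    (η : pullbackSections 𝔽 F V p) (z : M₂) {σ : smoothSections m 𝔽 F V}
    (hσ : ∀ᶠ w in 𝓝 z, σ.1 (p w) = η.1 w) :
    liftValue hp D η z = (D.toLinearMap σ).1 (p z) := by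
  refine D.congr (eventually_of_eventually_pullback hp ?_)
  filter_upwards [(exists_extension hp z η).choose_spec, hσ] with w h1 h2
  rw [h1, h2]

/-- The lift `D₂ : Γ(E₂) → Γ(E₂)` of a differential operator `D₁` on `E₁`. -/
def liftOperator [T2Space M₁] (D : DifferentialOperator m 𝔽 F V) :
    pullbackSections 𝔽 F V p →ₗ[𝔽] pullbackSections 𝔽 F V p where
  toFun η := ⟨fun z ↦ liftValue hp D η z, fun z ↦ by
    obtain ⟨σ, hσ⟩ := exists_extension hp z η
    rw [contMDiffAt_pullback_iff]
    refine ((D.toLinearMap σ).2.contMDiffAt.comp z p.contMDiff.contMDiffAt).congr_of_eventuallyEq ?_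
    filter_upwards [hσ.eventually_nhds] with w hw
    rw [liftValue_eq hp D η w hw]
    rfl⟩
  map_add' η θ := by
    ext z
    obtain ⟨σ, hσ⟩ := exists_extension hp z η
    obtain ⟨τ, hτ⟩ := exists_extension hp z θ
    have h : ∀ᶠ w in 𝓝 z, (σ + τ).1 (p w) = (η + θ).1 w := by
      filter_upwards [hσ, hτ] with w h1 h2
      exact congrArg₂ (· + ·) h1 h2
    change liftValue hp D (η + θ) z = liftValue hp D η z + liftValue hp D θ z
    rw [liftValue_eq hp D η z hσ, liftValue_eq hp D θ z hτ, liftValue_eq hp D (η + θ) z h, map_add]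
    rfl
  map_smul' c η := by
    ext z
    obtain ⟨σ, hσ⟩ := exists_extension hp z η
    have h : ∀ᶠ w in 𝓝 z, (c • σ).1 (p w) = (c • η).1 w := by
      filter_upwards [hσ] with w h1
      exact congrArg (c • ·) h1
    change liftValue hp D (c • η) z = c • liftValue hp D η z
    rw [liftValue_eq hp D η z hσ, liftValue_eq hp D (c • η) z h, map_smul]
    rfl

variable (𝔽 F V p) in
/-- The space `Γ_c(E₂)` of compactly supported smooth sections of `E₂ = p^* E₁`. -/
def compactSections : Submodule 𝔽 (pullbackSections 𝔽 F V p) where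
  carrier := {η | IsCompact (closure {z | η.1 z ≠ 0})}
  add_mem' {η θ} hη hθ := by
    refine (hη.union hθ).of_isClosed_subset isClosed_closure ?_
    rw [← closure_union]
    refine closure_mono fun z hz ↦ ?_
    by_contra! h
    simp only [mem_union, mem_ofPred_eq, not_or, not_not] at h
    exact hz (by change η.1 z + θ.1 z = 0; rw [h.1, h.2, add_zero])
  zero_mem' := by
    have : {z | (0 : pullbackSections 𝔽 F V p).1 z ≠ 0} = ∅ := by
      ext z; simp
    change IsCompact (closure _)
    rw [this]
    simp
  smul_mem' c η hη := by
    refine hη.of_isClosed_subset isClosed_closure (closure_mono fun z hz h ↦ hz ?_)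
    change c • η.1 z = 0
    rw [h, smul_zero]

/-- The restriction of the lifted operator to compactly supported sections. -/
def liftCompact [T2Space M₁] (D : DifferentialOperator m 𝔽 F V) :
    compactSections 𝔽 F V p →ₗ[𝔽] compactSections 𝔽 F V p :=
  (liftOperator hp D).restrict fun η hη ↦ by
    refine IsCompact.of_isClosed_subset hη isClosed_closure
      (closure_minimal (fun z hz ↦ ?_) isClosed_closure)
    by_contra hz'
    refine hz ?_
    have h : ∀ᶠ w in 𝓝 z, (0 : smoothSections m 𝔽 F V).1 (p w) = η.1 w := by
      filter_upwards [isClosed_closure.isOpen_compl.mem_nhds hz'] with w hw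
      by_contra hne
      exact hw (subset_closure fun h0 ↦ hne (by rw [h0]; rfl))
    change liftValue hp D η z = 0
    rw [liftValue_eq hp D η z h, map_zero]
    rfl

end Sections
noncomputable section Boundary

variable {m : ℕ} [NeZero m] {𝔽 : Type*} [RCLike 𝔽]
  {M₁ : Type*} [TopologicalSpace M₁] [ChartedSpace (EuclideanHalfSpace m) M₁]
  [IsManifold (𝓡∂ m) ∞ M₁]
  {M₂ : Type*} [TopologicalSpace M₂] [ChartedSpace (EuclideanHalfSpace m) M₂]
  {F : Type*} [NormedAddCommGroup F] [NormedSpace 𝔽 F] [NormedSpace ℝ F] [IsScalarTower ℝ 𝔽 F]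
  {V : M₁ → Type*} [TopologicalSpace (TotalSpace F V)] [∀ x, NormedAddCommGroup (V x)]
  [∀ x, InnerProductSpace 𝔽 (V x)] [∀ x, InnerProductSpace ℝ (V x)]
  [FiberBundle F V] [VectorBundle ℝ F V] [VectorBundle 𝔽 F V]
  {p : C^∞⟮𝓡∂ m, M₂; 𝓡∂ m, M₁⟯} (hp : IsLocalDiffeomorph (𝓡∂ m) (𝓡∂ m) ∞ p)

variable (m 𝔽 F V) in
/-- A smooth connection on a real or complex vector bundle; for `𝔽 = ℂ` it is complex linear
in the section. It is not assumed to be compatible with a metric. -/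
structure Connection where
  cov : CovariantDerivative (𝓡∂ m) F V
  smooth : cov.ContMDiffCovariantDerivative ∞
  map_smul : ∀ (c : 𝔽) {σ : Π x, V x} {x : M₁},
    MDifferentiableAt (𝓡∂ m) ((𝓡∂ m).prod 𝓘(ℝ, F)) (fun x ↦ (⟨x, σ x⟩ : TotalSpace F V)) x →
    ∀ v : TangentSpace (𝓡∂ m) x, cov (c • σ) x v = c • cov σ x v

/-- The pullback connection on `p^* E₁`, `p` a local diffeomorphism: for a section `η` that is
`p^* σ` near `z`, it is `∇_v η = ∇_{dp(v)} σ`. -/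
def pullbackCov (nabla : Connection m 𝔽 F V) (η : Π z, V (p z)) (z : M₂)
    (v : TangentSpace (𝓡∂ m) z) : V (p z) :=
  nabla.cov (descend hp z η) (p z) (mfderiv (𝓡∂ m) (𝓡∂ m) p z v)

lemma descend_mdifferentiableAt (z : M₂) {η : Π w, V (p w)} (hη : η ∈ pullbackSections 𝔽 F V p) :
    MDifferentiableAt (𝓡∂ m) ((𝓡∂ m).prod 𝓘(ℝ, F))
      (fun x ↦ (⟨x, descend hp z η x⟩ : TotalSpace F V)) (p z) :=
  ((descend_contMDiffOn hp z hη).contMDiffAt ((hp z).localInverse.open_source.mem_nhds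
    (hp z).localInverse_mem_source)).mdifferentiableAt (by simp)

theorem pullbackCov_eq (nabla : Connection m 𝔽 F V) (η : pullbackSections 𝔽 F V p) (z : M₂)
    (v : TangentSpace (𝓡∂ m) z) {σ : smoothSections m 𝔽 F V}
    (hσ : ∀ᶠ w in 𝓝 z, σ.1 (p w) = η.1 w) :
    pullbackCov hp nabla η.1 z v = nabla.cov σ.1 (p z) (mfderiv (𝓡∂ m) (𝓡∂ m) p z v) := by
  have h := nabla.cov.isCovariantDerivativeOnUniv.congr_of_eventuallyEq
    (descend_mdifferentiableAt hp z η.2) ((σ.2.contMDiffAt (x := p z)).mdifferentiableAt (by simp))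
    univ_mem (eventually_of_eventually_pullback hp (P := fun x ↦ descend hp z η.1 x = σ.1 x) (by
      filter_upwards [descend_eventually hp z η.1, hσ] with w h1 h2
      rw [h1, h2]))
  rw [pullbackCov, h]

lemma pullbackCov_add (nabla : Connection m 𝔽 F V) {η θ : Π z, V (p z)}
    (hη : η ∈ pullbackSections 𝔽 F V p) (hθ : θ ∈ pullbackSections 𝔽 F V p) (z : M₂)
    (v : TangentSpace (𝓡∂ m) z) :
    pullbackCov hp nabla (η + θ) z v = pullbackCov hp nabla η z v + pullbackCov hp nabla θ z v := by
  rw [pullbackCov, descend_add, nabla.cov.isCovariantDerivativeOnUniv.add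
    (descend_mdifferentiableAt hp z hη) (descend_mdifferentiableAt hp z hθ)]
  rfl

lemma pullbackCov_smul (nabla : Connection m 𝔽 F V) {η : Π z, V (p z)}
    (hη : η ∈ pullbackSections 𝔽 F V p) (c : 𝔽) (z : M₂) (v : TangentSpace (𝓡∂ m) z) :
    pullbackCov hp nabla (c • η) z v = c • pullbackCov hp nabla η z v := by
  rw [pullbackCov, descend_smul, nabla.map_smul c (descend_mdifferentiableAt hp z hη)]
  rfl

/-- The zeroth component of a tangent vector `v` at `x` in the preferred chart at `x`. Charts take
values in the half-space `{u | 0 ≤ u 0}`, so at a boundary point `v` is tangent to the boundary if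
this vanishes, and points inwards if it is positive. -/
def normalCoord {M : Type*} [TopologicalSpace M] [ChartedSpace (EuclideanHalfSpace m) M]
    (x : M) (v : TangentSpace (𝓡∂ m) x) : ℝ :=
  EuclideanSpace.proj (𝕜 := ℝ) (0 : Fin m)
    (mfderiv (𝓡∂ m) 𝓘(ℝ, EuclideanSpace ℝ (Fin m)) (extChartAt (𝓡∂ m) x) x v)

/-- `n` is the inward pointing unit normal at the boundary point `x`. -/
structure IsInwardNormal {M : Type*} [TopologicalSpace M] [ChartedSpace (EuclideanHalfSpace m) M]
    [RiemannianBundle (fun x : M ↦ TangentSpace (𝓡∂ m) x)] (x : M)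
    (n : TangentSpace (𝓡∂ m) x) : Prop where
  norm_eq_one : ‖n‖ = 1
  orthogonal : ∀ v : TangentSpace (𝓡∂ m) x, normalCoord x v = 0 → inner ℝ n v = 0
  inward : 0 < normalCoord x n

/-- The domain `𝓓(D₂)`: compactly supported smooth sections `η` of `E₂ = p^* E₁` with
`a₂ ∇_n η + b₂ η = 0` on `∂M₂`, where `a₂ = a ∘ p` and `b₂ = b ∘ p`. If `∂M₂` is empty, this is
`Γ_c(E₂)`. Only the values of `a` and `b` on `∂M₁` matter. -/
def boundaryDomain [RiemannianBundle (fun z : M₂ ↦ TangentSpace (𝓡∂ m) z)]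
    (nabla : Connection m 𝔽 F V) (a b : M₁ → 𝔽) : Submodule 𝔽 (compactSections 𝔽 F V p) where
  carrier := {η | ∀ z ∈ (𝓡∂ m).boundary M₂, ∀ n : TangentSpace (𝓡∂ m) z, IsInwardNormal z n →
    a (p z) • pullbackCov hp nabla η.1.1 z n + b (p z) • η.1.1 z = 0}
  add_mem' {η θ} hη hθ z hz n hn := by
    have h := congrArg₂ (· + ·) (hη z hz n hn) (hθ z hz n hn)
    change a (p z) • pullbackCov hp nabla (η.1.1 + θ.1.1) z n + b (p z) • (η.1.1 z + θ.1.1 z) = 0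
    rw [pullbackCov_add hp nabla η.1.2 θ.1.2]
    simp only [add_zero] at h
    rw [← h]
    module
  zero_mem' z hz n hn := by
    have h := pullbackCov_smul hp nabla (0 : compactSections 𝔽 F V p).1.2 (0 : 𝔽) z n
    rw [zero_smul, zero_smul] at h
    change a (p z) • pullbackCov hp nabla 0 z n + b (p z) • 0 = 0
    rw [h, smul_zero, smul_zero, add_zero]
  smul_mem' c η hη z hz n hn := by
    change a (p z) • pullbackCov hp nabla (c • η.1.1) z n + b (p z) • (c • η.1.1 z) = 0
    rw [pullbackCov_smul hp nabla η.1.2, smul_comm _ c, smul_comm _ c, ← smul_add, hη z hz n hn,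
      smul_zero]

end Boundary

noncomputable section HilbertSpace

variable {m : ℕ} [NeZero m] {𝔽 : Type*} [RCLike 𝔽]
  {M₁ : Type*} [TopologicalSpace M₁] [ChartedSpace (EuclideanHalfSpace m) M₁]
  {M₂ : Type*} [TopologicalSpace M₂] [ChartedSpace (EuclideanHalfSpace m) M₂]
  [IsManifold (𝓡∂ m) ∞ M₂] [MeasurableSpace M₂] [BorelSpace M₂]
  [RiemannianBundle (fun z : M₂ ↦ TangentSpace (𝓡∂ m) z)]
  [IsContMDiffRiemannianBundle (𝓡∂ m) ∞ (EuclideanSpace ℝ (Fin m))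
    (fun z : M₂ ↦ TangentSpace (𝓡∂ m) z)]
  {F : Type*} [NormedAddCommGroup F] [NormedSpace 𝔽 F] [NormedSpace ℝ F] [IsScalarTower ℝ 𝔽 F]
  {V : M₁ → Type*} [TopologicalSpace (TotalSpace F V)] [∀ x, NormedAddCommGroup (V x)]
  [∀ x, InnerProductSpace 𝔽 (V x)] [∀ x, InnerProductSpace ℝ (V x)]
  [FiberBundle F V] [VectorBundle ℝ F V] [VectorBundle 𝔽 F V]
  [IsContMDiffRiemannianBundle (𝓡∂ m) ∞ F V]
  {p : C^∞⟮𝓡∂ m, M₂; 𝓡∂ m, M₁⟯}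

lemma continuous_norm_sq_section (η : pullbackSections 𝔽 F V p) :
    Continuous fun z ↦ ‖η.1 z‖ ^ 2 := by
  have : IsContinuousRiemannianBundle F V := by
    obtain ⟨g, hg, hg'⟩ := IsContMDiffRiemannianBundle.exists_contMDiff (IB := 𝓡∂ m) (n := ∞)
      (F := F) (E := V)
    exact ⟨g, hg.continuous, hg'⟩
  have h := (pullbackSections_contMDiff p η.2).continuous
  have h2 := Continuous.inner_bundle h h
  simpa only [real_inner_self_eq_norm_sq] using h2

lemma continuous_inner_section (η θ : pullbackSections 𝔽 F V p) :
    Continuous fun z ↦ inner 𝔽 (η.1 z) (θ.1 z) := by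
  have h1 := continuous_norm_sq_section (η + θ)
  have h2 := continuous_norm_sq_section (η - θ)
  have h3 := continuous_norm_sq_section (η - (RCLike.I : 𝔽) • θ)
  have h4 := continuous_norm_sq_section (η + (RCLike.I : 𝔽) • θ)
  have := ((((RCLike.continuous_ofReal (K := 𝔽)).comp h1).sub
    ((RCLike.continuous_ofReal (K := 𝔽)).comp h2)).add
    ((((RCLike.continuous_ofReal (K := 𝔽)).comp h3).sub
    ((RCLike.continuous_ofReal (K := 𝔽)).comp h4)).mul_const (RCLike.I : 𝔽))).div_const (4 : 𝔽)
  refine this.congr fun z ↦ ?_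
  rw [inner_eq_sum_norm_sq_div_four]
  change (((‖η.1 z + θ.1 z‖ ^ 2 : ℝ) : 𝔽) - ((‖η.1 z - θ.1 z‖ ^ 2 : ℝ) : 𝔽) +
    (((‖η.1 z - (RCLike.I : 𝔽) • θ.1 z‖ ^ 2 : ℝ) : 𝔽) -
      ((‖η.1 z + (RCLike.I : 𝔽) • θ.1 z‖ ^ 2 : ℝ) : 𝔽)) * (RCLike.I : 𝔽)) / (4 : 𝔽) = _
  simp only [RCLike.ofReal_pow]

lemma hasCompactSupport_inner_section (η θ : compactSections 𝔽 F V p) :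
    HasCompactSupport fun z ↦ inner 𝔽 (η.1.1 z) (θ.1.1 z) := by
  refine IsCompact.of_isClosed_subset η.2 isClosed_closure (closure_mono fun z hz h ↦ hz ?_)
  have h' : η.1.1 z = 0 := h
  change inner 𝔽 (η.1.1 z) (θ.1.1 z) = 0
  rw [h', inner_zero_left]

lemma integrable_inner_section (η θ : compactSections 𝔽 F V p) :
    Integrable (fun z ↦ inner 𝔽 (η.1.1 z) (θ.1.1 z)) (riemannianVolume m M₂) :=
  (continuous_inner_section η.1 θ.1).integrable_of_hasCompactSupport
    (hasCompactSupport_inner_section η θ)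

variable (𝔽 F V p) in
/-- The space `Γ_c(E₂)`, regarded as a normed space with the `L²` norm. -/
def TestSection : Type _ := compactSections 𝔽 F V p

instance : AddCommGroup (TestSection 𝔽 F V p) :=
  inferInstanceAs (AddCommGroup (compactSections 𝔽 F V p))

instance : Module 𝔽 (TestSection 𝔽 F V p) :=
  inferInstanceAs (Module 𝔽 (compactSections 𝔽 F V p))

/-- The `L²` inner product `∫ ⟨η, θ⟩` on `Γ_c(E₂)`, with respect to the Riemannian volume. -/
@[reducible]
def innerCore : InnerProductSpace.Core 𝔽 (TestSection 𝔽 F V p) where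
  inner η θ := ∫ z, inner 𝔽 (η.1.1 z) (θ.1.1 z) ∂(riemannianVolume m M₂)
  conj_inner_symm η θ := by
    rw [← integral_conj]
    simp only [inner_conj_symm]
  re_inner_nonneg η := by
    rw [← integral_re (integrable_inner_section η η)]
    exact integral_nonneg fun z ↦ inner_self_nonneg
  add_left η θ ξ := by
    rw [← integral_add (integrable_inner_section η ξ) (integrable_inner_section θ ξ)]
    exact integral_congr_ae (.of_forall fun z ↦ inner_add_left _ _ _)
  smul_left η θ c := by
    rw [← integral_const_mul]
    exact integral_congr_ae (.of_forall fun z ↦ inner_smul_left _ _ _)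
  definite η h := by
    by_contra hne
    have h0 : ∃ z, η.1.1 z ≠ 0 := by
      by_contra! h'
      exact hne (Subtype.ext (Subtype.ext (funext h')))
    obtain ⟨z, hz⟩ := h0
    have hc := continuous_norm_sq_section η.1
    have hs : HasCompactSupport fun z ↦ ‖η.1.1 z‖ ^ 2 := by
      refine IsCompact.of_isClosed_subset η.2 isClosed_closure (closure_mono fun z hz h ↦ hz ?_)
      simp [h]
    have hpos := hc.integral_pos_of_hasCompactSupport_nonneg_nonzero (x := z)
      (μ := riemannianVolume m M₂) hs (fun z ↦ sq_nonneg _) (by simpa using hz)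
    simp only [inner_self_eq_norm_sq_to_K] at h
    rw [show (fun z ↦ ((‖η.1.1 z‖ : 𝔽)) ^ 2) = fun z ↦ ((‖η.1.1 z‖ ^ 2 : ℝ) : 𝔽) by
      funext z; push_cast; rfl, integral_ofReal] at h
    exact hpos.ne' (by exact_mod_cast h)

instance : NormedAddCommGroup (TestSection 𝔽 F V p) :=
  @InnerProductSpace.Core.toNormedAddCommGroup 𝔽 _ _ _ _ innerCore

instance : InnerProductSpace 𝔽 (TestSection 𝔽 F V p) :=
  InnerProductSpace.ofCore innerCore.toCore

variable (𝔽 F V p) in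
/-- The Hilbert space `L²(E₂)`: the completion of `Γ_c(E₂)` with respect to the `L²` norm. -/
abbrev L2Sections : Type _ := UniformSpace.Completion (TestSection 𝔽 F V p)

variable (𝔽 F V p) in
/-- The inclusion `Γ_c(E₂) → L²(E₂)`. -/
def toL2 : TestSection 𝔽 F V p →ₗ[𝔽] L2Sections 𝔽 F V p :=
  UniformSpace.Completion.toComplₗᵢ.toLinearMap

lemma toL2_injective : Function.Injective (toL2 𝔽 F V p) :=
  UniformSpace.Completion.toComplₗᵢ.injective

variable [IsManifold (𝓡∂ m) ∞ M₁] [T2Space M₁]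

/-- The domain `𝓓(D₂)` as a subspace of `Γ_c(E₂)` with its `L²` norm. -/
def testDomain (hp : IsLocalDiffeomorph (𝓡∂ m) (𝓡∂ m) ∞ p)
    (nabla : Connection m 𝔽 F V) (a b : M₁ → 𝔽) : Submodule 𝔽 (TestSection 𝔽 F V p) :=
  boundaryDomain hp nabla a b

/-- The lift `D₂`, acting on `Γ_c(E₂)` with its `L²` norm. -/
def testLift (hp : IsLocalDiffeomorph (𝓡∂ m) (𝓡∂ m) ∞ p) (D : DifferentialOperator m 𝔽 F V) :
    TestSection 𝔽 F V p →ₗ[𝔽] TestSection 𝔽 F V p :=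
  liftCompact hp D

/-- The lift `D₂` of `D`, as an operator `L²(E₂) ⊇ 𝓓(D₂) → L²(E₂)`. -/
def liftedOperator (hp : IsLocalDiffeomorph (𝓡∂ m) (𝓡∂ m) ∞ p) (D : DifferentialOperator m 𝔽 F V)
    (nabla : Connection m 𝔽 F V) (a b : M₁ → 𝔽) :
    L2Sections 𝔽 F V p →ₗ.[𝔽] L2Sections 𝔽 F V p where
  domain := Submodule.map (toL2 𝔽 F V p) (testDomain hp nabla a b)
  toFun := toL2 𝔽 F V p ∘ₗ testLift hp D ∘ₗ (testDomain hp nabla a b).subtype ∘ₗ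
    (Submodule.equivMapOfInjective (toL2 𝔽 F V p) toL2_injective
      (testDomain hp nabla a b)).symm.toLinearMap

theorem liftedOperator_apply (hp : IsLocalDiffeomorph (𝓡∂ m) (𝓡∂ m) ∞ p)
    (D : DifferentialOperator m 𝔽 F V) (nabla : Connection m 𝔽 F V) (a b : M₁ → 𝔽)
    {η : TestSection 𝔽 F V p} (hη : η ∈ testDomain hp nabla a b) :
    liftedOperator hp D nabla a b ⟨toL2 𝔽 F V p η, Submodule.mem_map_of_mem hη⟩ =
      toL2 𝔽 F V p (testLift hp D η) := by
  let e := Submodule.equivMapOfInjective (toL2 𝔽 F V p) toL2_injective (testDomain hp nabla a b)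
  have h : e.symm (e ⟨η, hη⟩) = ⟨η, hη⟩ := e.symm_apply_apply _
  have h2 : toL2 𝔽 F V p (testLift hp D (e.symm (e ⟨η, hη⟩)).1) =
      toL2 𝔽 F V p (testLift hp D η) := by rw [h]
  exact h2

end HilbertSpace

section Spectrum

variable {𝔽 : Type*} [RCLike 𝔽] {H : Type*} [NormedAddCommGroup H] [InnerProductSpace 𝔽 H]

/-- The operator `A - μ` on the domain of `A`. -/
def shift (A : H →ₗ.[𝔽] H) (μ : 𝔽) : A.domain →ₗ[𝔽] H :=
  A.toFun - μ • A.domain.subtype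

/-- The spectrum `σ(A)`: all `μ` such that `A - μ` is not bijective from the domain to `H`. -/
def spectrum (A : H →ₗ.[𝔽] H) : Set 𝔽 :=
  {μ | ¬ Function.Bijective (shift A μ)}

/-- A linear map is Fredholm if it has finite-dimensional kernel and closed range of finite
codimension. -/
def IsFredholm {X : Type*} [AddCommGroup X] [Module 𝔽 X] (T : X →ₗ[𝔽] H) : Prop :=
  FiniteDimensional 𝔽 (LinearMap.ker T) ∧ IsClosed (LinearMap.range T : Set H) ∧
    FiniteDimensional 𝔽 (H ⧸ LinearMap.range T)

/-- The essential spectrum `σ_ess(A)`: all `μ` such that `A - μ` is not Fredholm. -/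
def essSpectrum (A : H →ₗ.[𝔽] H) : Set 𝔽 :=
  {μ | ¬ IsFredholm (shift A μ)}

/-- `μ` is an eigenvalue of `A`, and its eigenspace is finite-dimensional. -/
def IsEigenvalueOfFiniteMultiplicity (A : H →ₗ.[𝔽] H) (μ : 𝔽) : Prop :=
  LinearMap.ker (shift A μ) ≠ ⊥ ∧ FiniteDimensional 𝔽 (LinearMap.ker (shift A μ))

/-- `A` is essentially self-adjoint: it is densely defined and closable, and its closure is
self-adjoint. -/
structure IsEssentiallySelfAdjoint [CompleteSpace H] (A : H →ₗ.[𝔽] H) : Prop where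
  dense : Dense (A.domain : Set H)
  isClosable : A.IsClosable
  isSelfAdjoint : IsSelfAdjoint A.closure

end Spectrum

section Covering

/-- The group of deck transformations of `p`: homeomorphisms `g` with `p ∘ g = p`. -/
def deckGroup {X Y : Type*} [TopologicalSpace X] (p : X → Y) : Subgroup (X ≃ₜ X) where
  carrier := {g | ∀ x, p (g x) = p x}
  mul_mem' {g h} hg hh x := (hg (h x)).trans (hh x)
  one_mem' _ := rfl
  inv_mem' {g} hg x := by
    have h := hg (g⁻¹ x)
    rwa [← Homeomorph.mul_apply, mul_inv_cancel, eq_comm] at h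

/-- A Riemannian covering: a smooth covering map which is a local isometry. -/
structure IsRiemannianCovering {m : ℕ} [NeZero m]
    {M₁ : Type*} [TopologicalSpace M₁] [ChartedSpace (EuclideanHalfSpace m) M₁]
    [RiemannianBundle (fun x : M₁ ↦ TangentSpace (𝓡∂ m) x)]
    {M₂ : Type*} [TopologicalSpace M₂] [ChartedSpace (EuclideanHalfSpace m) M₂]
    [RiemannianBundle (fun z : M₂ ↦ TangentSpace (𝓡∂ m) z)]
    (p : C^∞⟮𝓡∂ m, M₂; 𝓡∂ m, M₁⟯) : Prop where
  isCoveringMap : IsCoveringMap p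
  isLocalDiffeomorph : IsLocalDiffeomorph (𝓡∂ m) (𝓡∂ m) ∞ p
  isometric : ∀ (z : M₂) (v w : TangentSpace (𝓡∂ m) z),
    inner (E := TangentSpace (𝓡∂ m) (p z)) ℝ (mfderiv (𝓡∂ m) (𝓡∂ m) p z v)
      (mfderiv (𝓡∂ m) (𝓡∂ m) p z w) = inner (E := TangentSpace (𝓡∂ m) z) ℝ v w

end Covering

end RiemCover

/-! A deck transformation `g` acts on sections of `p^* E₁` by pullback: the fibres over `z` and `g
z` are both the fibre of `E₁` over `p z`. The metrics, the connection, the operator and the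
coefficients of the boundary condition all come from `M₁`, so this action preserves them. Since `p`
is a local isometry, `g` is an isometry of `M₂` and preserves volume. Pullback by `g` therefore
extends to a linear isometry `U g` of `L²`, under which the graph of `D₂`, and hence that of its
closure, is invariant (`liftedOperator_graph_invariant`).

The deck group acts properly discontinuously (`finite_setOf_deckGroup`). For compactly supported `η`
and `θ`, the supports of `g^* η` and `θ` are thus disjoint for all but finitely many `g`, and `⟨θ, U
g η⟩ = 0` for these. By density, all matrix coefficients `⟨v, U g u⟩` tend to zero along the
cofinite filter, which is proper because the deck group is infinite. An invariant subspace `W` of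
finite dimension must then vanish: for an orthonormal basis `b j` of `W` and `x` in `W`, the number
`‖x‖² = ∑ ‖⟨b j, U g x⟩‖²` does not depend on `g` and tends to zero (`eq_bot_of_invariant`). Applied
to eigenspaces, this excludes eigenvalues of finite multiplicity.

The equality of the spectra is then formal (`spectrum_eq_essSpectrum`). If `A` is self-adjoint and
`A - μ` is Fredholm, then its kernel and the orthogonal complement of its range, which is the kernel
of `A - conj μ`, are finite-dimensional eigenspaces, hence zero. As the range is closed, `A - μ` is
bijective. No ellipticity of the operator and no completeness of the manifolds enters. -/

namespace RiemCover

/-! ### Isometries with vanishing matrix coefficients; spectra of self-adjoint operators -/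

section FunctionalAnalysis

variable {𝔽 : Type*} [RCLike 𝔽] {H : Type*} [NormedAddCommGroup H] [InnerProductSpace 𝔽 H]

/-- A linear isometry of an inner product space extends to its completion. -/
lemma exists_completion_linearIsometry (T : H →ₗᵢ[𝔽] H) :
    ∃ U : UniformSpace.Completion H →ₗᵢ[𝔽] UniformSpace.Completion H,
      ∀ x : H, U x = (T x : UniformSpace.Completion H) := by
  let f : H →L[𝔽] UniformSpace.Completion H :=
    (UniformSpace.Completion.toComplₗᵢ.comp T).toContinuousLinearMap
  let e : H →L[𝔽] UniformSpace.Completion H := UniformSpace.Completion.toComplL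
  have hd : DenseRange e := UniformSpace.Completion.denseRange_coe
  have he : IsUniformInducing e := UniformSpace.Completion.isUniformInducing_coe H
  have h : ∀ x : H, f.extend e x = (T x : UniformSpace.Completion H) := fun x ↦
    f.extend_eq hd he x
  refine ⟨⟨(f.extend e).toLinearMap, fun x ↦ ?_⟩, h⟩
  refine UniformSpace.Completion.induction_on x
    (isClosed_eq (f.extend e).continuous.norm continuous_norm) fun y ↦ ?_
  change ‖f.extend e y‖ = _
  rw [h, UniformSpace.Completion.norm_coe, UniformSpace.Completion.norm_coe, T.norm_map]

/-- If the matrix coefficients of a family of isometries vanish at infinity on a dense set, then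
they all do. -/
lemma tendsto_inner_zero_of_dense {ι : Type*} {l : Filter ι} {U : ι → H →ₗᵢ[𝔽] H} {S : Set H}
    (hS : Dense S)
    (hU : ∀ u ∈ S, ∀ v ∈ S, Tendsto (fun i ↦ inner 𝔽 v (U i u)) l (𝓝 0)) (u v : H) :
    Tendsto (fun i ↦ inner 𝔽 v (U i u)) l (𝓝 0) := by
  rw [Metric.tendsto_nhds]
  intro ε hε
  -- The order of choice matters: `v'` is fixed first, with a tolerance depending on `‖u‖`, and the
  -- tolerance for `u'` depends on `‖v'‖`. Since each `U i` is an isometry, the two approximation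
  -- errors are at most `ε / 3` uniformly in `i`. The summand `1` only keeps the denominators
  -- positive.
  obtain ⟨v', hv', hvS⟩ := Metric.dense_iff.1 hS v (ε / (3 * (‖u‖ + 1))) (by positivity)
  obtain ⟨u', hu', huS⟩ := Metric.dense_iff.1 hS u (ε / (3 * (‖v'‖ + 1))) (by positivity)
  rw [mem_ball_iff_norm'] at hv' hu'
  filter_upwards [(Metric.tendsto_nhds.1 (hU u' huS v' hvS)) (ε / 3) (by positivity)] with i hi
  rw [dist_zero_right] at hi ⊢
  have h1 : ‖inner 𝔽 (v - v') (U i u)‖ ≤ ε / 3 := by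
    refine (norm_inner_le_norm _ _).trans ?_
    rw [(U i).norm_map]
    rw [lt_div_iff₀ (by positivity)] at hv'
    nlinarith [norm_nonneg (v - v'), norm_nonneg u]
  have h2 : ‖inner 𝔽 v' (U i (u - u'))‖ ≤ ε / 3 := by
    refine (norm_inner_le_norm _ _).trans ?_
    rw [(U i).norm_map]
    rw [lt_div_iff₀ (by positivity)] at hu'
    nlinarith [norm_nonneg (u - u'), norm_nonneg v']
  have h3 : inner 𝔽 v (U i u) =
      inner 𝔽 (v - v') (U i u) + inner 𝔽 v' (U i (u - u')) + inner 𝔽 v' (U i u') := by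
    rw [map_sub, inner_sub_left, inner_sub_right]
    ring
  rw [h3]
  linarith [norm_add₃_le (a := inner 𝔽 (v - v') (U i u)) (b := inner 𝔽 v' (U i (u - u')))
    (c := inner 𝔽 v' (U i u'))]

/-- A finite-dimensional subspace that is invariant under a family of isometries whose matrix
coefficients vanish at infinity is trivial. -/
lemma eq_bot_of_invariant {ι : Type*} {l : Filter ι} [l.NeBot] {U : ι → H →ₗᵢ[𝔽] H}
    (hU : ∀ u v : H, Tendsto (fun i ↦ inner 𝔽 v (U i u)) l (𝓝 0))
    (W : Submodule 𝔽 H) [FiniteDimensional 𝔽 W] (hW : ∀ i, ∀ x ∈ W, U i x ∈ W) : W = ⊥ := by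
  rw [Submodule.eq_bot_iff]
  intro x hx
  let b := stdOrthonormalBasis 𝔽 W
  -- Parseval in `W`, which applies because `U i x` stays in `W`. Finite dimension is needed next,
  -- to pass to the limit term by term.
  have h1 : ∀ i, ∑ j, ‖inner 𝔽 (b j : H) (U i x)‖ ^ 2 = ‖x‖ ^ 2 := fun i ↦ by
    have := b.sum_sq_norm_inner_right ⟨U i x, hW i x hx⟩
    simpa using this
  have h2 : Tendsto (fun i ↦ ∑ j, ‖inner 𝔽 (b j : H) (U i x)‖ ^ 2) l (𝓝 0) := by
    have := tendsto_finsetSum (Finset.univ) fun j _ ↦ ((hU x (b j)).norm.pow 2)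
    simpa using this
  simp only [h1] at h2
  have := tendsto_nhds_unique h2 tendsto_const_nhds
  simpa using this.symm

/-- Eigenvectors are expressed through the graph because invariance under isometries and passage to
the closure are both statements about graphs. -/
lemma mem_ker_shift_iff {A : H →ₗ.[𝔽] H} {μ : 𝔽} {x : A.domain} :
    x ∈ LinearMap.ker (shift A μ) ↔ ((x : H), μ • (x : H)) ∈ A.graph := by
  rw [LinearMap.mem_ker, LinearPMap.mem_graph_iff]
  constructor
  · intro h
    exact ⟨x, rfl, sub_eq_zero.1 h⟩
  · rintro ⟨y, hy, hy'⟩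
    obtain rfl := Subtype.ext hy
    exact sub_eq_zero.2 hy'

/-- If the graph of a closable operator is invariant under a family of isometries whose matrix
coefficients vanish at infinity, then its closure has no eigenvalue of finite multiplicity. -/
theorem not_isEigenvalueOfFiniteMultiplicity {ι : Type*} {l : Filter ι} [l.NeBot]
    {U : ι → H →ₗᵢ[𝔽] H}
    (hU : ∀ u v : H, Tendsto (fun i ↦ inner 𝔽 v (U i u)) l (𝓝 0)) {A : H →ₗ.[𝔽] H}
    (hA : A.IsClosable) (hinv : ∀ i, ∀ x ∈ A.graph, (U i x.1, U i x.2) ∈ A.graph) (μ : 𝔽) :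
    ¬ IsEigenvalueOfFiniteMultiplicity A.closure μ := by
  rintro ⟨hne, hfin⟩
  have hinv' : ∀ i, ∀ x ∈ A.closure.graph, (U i x.1, U i x.2) ∈ A.closure.graph := by
    intro i x hx
    -- For a closable operator the graph of the closure is the closure of the graph, so invariance
    -- passes to it by continuity of `U i × U i`.
    rw [← hA.graph_closure_eq_closure_graph] at hx ⊢
    refine map_mem_closure (f := fun x : H × H ↦ (U i x.1, U i x.2)) ?_ hx (hinv i)
    exact ((U i).continuous.comp continuous_fst).prodMk ((U i).continuous.comp continuous_snd)
  have := eq_bot_of_invariant hU ((LinearMap.ker (shift A.closure μ)).map A.closure.domain.subtype)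
    (by
      rintro i _ ⟨x, hx, rfl⟩
      have h := hinv' i _ (mem_ker_shift_iff.1 hx)
      rw [map_smul] at h
      exact ⟨⟨U i x, LinearPMap.mem_domain_of_mem_graph h⟩, mem_ker_shift_iff.2 h, rfl⟩)
  exact hne (Submodule.map_injective_of_injective (Submodule.subtype_injective _)
    (this.trans (Submodule.map_bot _).symm))

/-- The spectrum of a self-adjoint operator without eigenvalues of finite multiplicity is
essential. -/
theorem spectrum_eq_essSpectrum [CompleteSpace H] {A : H →ₗ.[𝔽] H} (hA : IsSelfAdjoint A)
    (hfin : ∀ μ : 𝔽, ¬ IsEigenvalueOfFiniteMultiplicity A μ) :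
    spectrum A = essSpectrum A := by
  ext μ
  refine not_congr ⟨fun h ↦ ?_, fun ⟨h1, h2, h3⟩ ↦ ?_⟩
  · refine ⟨?_, ?_, ?_⟩
    · rw [LinearMap.ker_eq_bot.2 h.1]
      infer_instance
    · rw [LinearMap.range_eq_top.2 h.2]
      exact isClosed_univ
    · rw [LinearMap.range_eq_top.2 h.2]
      infer_instance
  · have hd : Dense (A.domain : Set H) := hA.dense_domain
    have hadj : A.adjoint = A := hA
    refine ⟨?_, ?_⟩
    · rw [← LinearMap.ker_eq_bot]
      by_contra hne
      exact hfin μ ⟨hne, h1⟩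
    · set R := LinearMap.range (shift A μ) with hR
      -- The complement of the range of `A - μ` is the eigenspace for `conj μ`. Symmetry of `A`
      -- gives one inclusion; the other needs the adjoint to have no larger domain than `A`.
      have hmap : (LinearMap.ker (shift A (starRingEnd 𝔽 μ))).map A.domain.subtype = Rᗮ := by
        ext y
        constructor
        · rintro ⟨x, hx, rfl⟩
          rw [Submodule.mem_orthogonal']
          rintro _ ⟨w, rfl⟩
          have h4 : A x = starRingEnd 𝔽 μ • (x : H) := sub_eq_zero.1 hx
          have h5 : inner 𝔽 (A x) (w : H) = inner 𝔽 (x : H) (A w) := by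
            have := LinearPMap.adjoint_isFormalAdjoint hd
            rw [hadj] at this
            exact this x w
          change inner 𝔽 (x : H) (A w - μ • (w : H)) = 0
          rw [inner_sub_right, ← h5, h4, inner_smul_left, inner_smul_right, RCLike.conj_conj,
            sub_self]
        · intro hy
          -- Orthogonality of `y` to the range says that `w ↦ ⟨y, A w⟩` is represented by `conj μ •
          -- y`. This puts `y` in the domain of the adjoint, which is `A` itself.
          have key : ∀ w : A.domain,
              inner 𝔽 (starRingEnd 𝔽 μ • y) (w : H) = inner 𝔽 y (A w) := by
            intro w
            have h4 : inner 𝔽 y (A w - μ • (w : H)) = 0 :=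
              (Submodule.mem_orthogonal' _ _).1 hy _ ⟨w, rfl⟩
            rw [inner_sub_right, inner_smul_right, sub_eq_zero] at h4
            rw [inner_smul_left, RCLike.conj_conj, h4]
          have hy' : y ∈ A.adjoint.domain := LinearPMap.mem_adjoint_domain_of_exists _ ⟨_, key⟩
          have h6 := LinearPMap.adjoint_apply_eq hd ⟨y, hy'⟩ key
          have h7 : (y, starRingEnd 𝔽 μ • y) ∈ A.graph := by
            rw [← hadj, LinearPMap.mem_graph_iff]
            exact ⟨⟨y, hy'⟩, rfl, h6⟩
          exact ⟨⟨y, LinearPMap.mem_domain_of_mem_graph h7⟩, mem_ker_shift_iff.2 h7, rfl⟩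
      have hbot : Rᗮ = ⊥ := by
        have h8 : FiniteDimensional 𝔽 Rᗮ := by
          -- The complement meets `R` trivially, so it embeds into the finite-dimensional quotient
          -- by `R`.
          refine FiniteDimensional.of_injective (R.mkQ ∘ₗ Rᗮ.subtype) ?_
          rw [← LinearMap.ker_eq_bot, LinearMap.ker_comp, Submodule.ker_mkQ,
            ← Submodule.disjoint_iff_comap_eq_bot]
          exact R.orthogonal_disjoint.symm
        by_contra hne
        refine hfin (starRingEnd 𝔽 μ) ⟨fun h9 ↦ hne ?_, ?_⟩
        · rw [← hmap, h9, Submodule.map_bot]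
        · rw [← hmap] at h8
          exact (Submodule.equivMapOfInjective _ (Submodule.subtype_injective _)
            _).symm.finiteDimensional
      rw [← LinearMap.range_eq_top, ← hR]
      -- Without closedness, a trivial complement would only give a dense range.
      have : CompleteSpace R := h2.completeSpace_coe
      exact Submodule.orthogonal_eq_bot_iff.1 hbot

end FunctionalAnalysis

/-! ### Proper discontinuity of the deck group -/

section ProperDiscontinuity

/-- The half-space is a retract of Euclidean space, hence a quotient of it, and quotients inherit
local connectedness. Through charts the property passes to `M₂`. -/
instance (m : ℕ) [NeZero m] : LocallyConnectedSpace (EuclideanHalfSpace m) := by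
  have h : IsQuotientMap (𝓡∂ m).symm :=
    IsQuotientMap.of_inverse (𝓡∂ m).continuous (𝓡∂ m).continuous_symm (𝓡∂ m).left_inv
  exact h.isCoinducing.locallyConnectedSpace

variable {X Y : Type*} [TopologicalSpace X] [TopologicalSpace Y] {p : X → Y}

/-- Deck transformations are lifts of `p` through `p` itself, and lifts from a connected space are
determined by one value. -/
lemma deckGroup_eq_of_apply_eq [PreconnectedSpace X] (hp : IsCoveringMap p) {g h : deckGroup p}
    {x : X} (hx : g.1 x = h.1 x) : g = h := by
  refine Subtype.ext (Homeomorph.ext fun y ↦ congrFun (hp.eq_of_comp_eq (g₁ := g.1) (g₂ := h.1)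
    g.1.continuous h.1.continuous ?_ x hx) y)
  funext y
  exact (g.2 y).trans (h.2 y).symm

/-- Any two points have neighbourhoods such that at most one deck transformation moves the first
neighbourhood to a set meeting the second. -/
lemma exists_nhds_subsingleton_deckGroup [PreconnectedSpace X] [LocallyConnectedSpace X]
    [T2Space Y] (hp : IsCoveringMap p) (x y : X) :
    ∃ A ∈ 𝓝 x, ∃ B ∈ 𝓝 y, {g : deckGroup p | ∃ z ∈ A, g.1 z ∈ B}.Subsingleton := by
  by_cases hxy : p x = p y
  · obtain ⟨e, hye, rfl⟩ := hp.isLocalHomeomorph y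
    have hA : e ⁻¹' e.target ∈ 𝓝 x := by
      refine hp.continuous.continuousAt.preimage_mem_nhds (e.open_target.mem_nhds ?_)
      rw [hxy]
      exact e.map_source hye
    -- The first neighbourhood is connected and lies over the target of the local section `e.symm`
    -- near `y`, so `e.symm ∘ e` is a continuous lift there.
    refine ⟨connectedComponentIn (e ⁻¹' e.target) x, connectedComponentIn_mem_nhds hA, e.source,
      e.open_source.mem_nhds hye, ?_⟩
    -- If `g z` lies in `e.source`, then `g` and `e.symm ∘ e` agree at `z`. Both lift `e`, so they
    -- agree on the connected neighbourhood. Hence `g x` does not depend on `g`.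
    have key : ∀ g ∈ {g : deckGroup e | ∃ z ∈ connectedComponentIn (e ⁻¹' e.target) x,
        g.1 z ∈ e.source}, g.1 x = e.symm (e x) := by
      rintro g ⟨z, hz, hgz⟩
      have hsub := connectedComponentIn_subset (e ⁻¹' e.target) x
      refine hp.eqOn_of_comp_eqOn (g₁ := g.1) (g₂ := e.symm ∘ e)
        (isPreconnected_connectedComponentIn (x := x) (F := e ⁻¹' e.target))
        g.1.continuous.continuousOn
        (e.symm.continuousOn.comp hp.continuous.continuousOn hsub) ?_ hz ?_
        (mem_connectedComponentIn (mem_of_mem_nhds hA))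
      · intro w hw
        have h1 : e (e.symm (e w)) = e w := e.right_inv (hsub hw)
        exact (g.2 w).trans h1.symm
      · have h2 := e.left_inv hgz
        rw [g.2 z] at h2
        exact h2.symm
    exact fun g hg h hh ↦ deckGroup_eq_of_apply_eq hp ((key g hg).trans (key h hh).symm)
  -- For points in different fibres no deck transformation qualifies, since each preserves the
  -- fibres over disjoint sets of the base.
  · obtain ⟨A, B, hA, hB, hxA, hyB, hAB⟩ := t2_separation hxy
    refine ⟨p ⁻¹' A, hp.continuous.continuousAt.preimage_mem_nhds (hA.mem_nhds hxA), p ⁻¹' B,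
      hp.continuous.continuousAt.preimage_mem_nhds (hB.mem_nhds hyB), ?_⟩
    rintro g ⟨z, hz, hgz⟩
    have h : p (g.1 z) ∈ B := hgz
    rw [g.2 z] at h
    exact (hAB.le_bot ⟨hz, h⟩).elim

/-- The deck group acts properly discontinuously. -/
theorem finite_setOf_deckGroup [PreconnectedSpace X] [LocallyConnectedSpace X]
    [T2Space Y] (hp : IsCoveringMap p) {K L : Set X} (hK : IsCompact K) (hL : IsCompact L) :
    {g : deckGroup p | ∃ z ∈ K, g.1 z ∈ L}.Finite := by
  -- Rephrased as a property of subsets of the compact product that is monotone and stable under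
  -- unions, the claim reduces to small neighbourhoods of a pair of points.
  have h : {g : deckGroup p | ∃ w ∈ K ×ˢ L, g.1 w.1 = w.2}.Finite := by
    refine (hK.prod hL).induction_on
      (p := fun S ↦ {g : deckGroup p | ∃ w ∈ S, g.1 w.1 = w.2}.Finite) ?_ ?_ ?_ ?_
    · simp
    · exact fun S T hST hT ↦ hT.subset fun g ⟨w, hw, hg⟩ ↦ ⟨w, hST hw, hg⟩
    · refine fun S T hS hT ↦ (hS.union hT).subset ?_
      rintro g ⟨w, hw | hw, hg⟩
      · exact Or.inl ⟨w, hw, hg⟩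
      · exact Or.inr ⟨w, hw, hg⟩
    · rintro ⟨x, y⟩ -
      obtain ⟨A, hA, B, hB, hAB⟩ := exists_nhds_subsingleton_deckGroup hp x y
      refine ⟨A ×ˢ B, mem_nhdsWithin_of_mem_nhds (prod_mem_nhds hA hB), hAB.finite.subset ?_⟩
      rintro g ⟨w, hw, hg⟩
      exact ⟨w.1, hw.1, hg ▸ hw.2⟩
  exact h.subset fun g ⟨z, hz, hg⟩ ↦ ⟨(z, g.1 z), ⟨hz, hg⟩, rfl⟩

end ProperDiscontinuity

/-! ### Isometries, inward normals and Riemannian volume -/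

section Isometries

variable {m : ℕ} [NeZero m]
  {M : Type*} [TopologicalSpace M] [ChartedSpace (EuclideanHalfSpace m) M]
  [IsManifold (𝓡∂ m) ∞ M]

local notation "𝔼" => EuclideanSpace ℝ (Fin m)

/-- The tangent space at `x` is modelled on the preferred chart at `x`, whose differential at `x` is
therefore the identity. -/
lemma normalCoord_eq (x : M) (v : TangentSpace (𝓡∂ m) x) :
    normalCoord x v = EuclideanSpace.proj (𝕜 := ℝ) (0 : Fin m) (v : 𝔼) := by
  have : IsManifold (𝓡∂ m) 1 M := .of_le (n := ∞) (by simp)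
  rw [normalCoord, mfderiv_extChartAt_self]
  rfl

/-- At a boundary point, a diffeomorphism multiplies the normal component of tangent vectors by a
positive factor. -/
lemma exists_pos_normalCoord_mfderiv (Φ : M ≃ₘ^∞⟮𝓡∂ m, 𝓡∂ m⟯ M) {z : M}
    (hz : z ∈ (𝓡∂ m).boundary M) :
    ∃ c : ℝ, 0 < c ∧ ∀ v : TangentSpace (𝓡∂ m) z,
      normalCoord (Φ z) (mfderiv (𝓡∂ m) (𝓡∂ m) Φ z v) = c * normalCoord z v := by
  have : IsManifold (𝓡∂ m) 1 M := .of_le (n := ∞) (by simp)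
  have hΦz : Φ z ∈ (𝓡∂ m).boundary M :=
    (Φ.isLocalDiffeomorph z).isBoundaryPoint_iff (by simp) |>.1 hz
  let L : 𝔼 →L[ℝ] 𝔼 := mfderiv (𝓡∂ m) (𝓡∂ m) Φ z
  have hL : HasFDerivWithinAt (writtenInExtChartAt (𝓡∂ m) (𝓡∂ m) z Φ) L (range (𝓡∂ m))
      (extChartAt (𝓡∂ m) z z) :=
    ((Φ.contMDiff z).mdifferentiableAt (by simp)).hasMFDerivAt.2
  let ℓ : 𝔼 →L[ℝ] ℝ := EuclideanSpace.proj (𝕜 := ℝ) (0 : Fin m)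
  have hrange : ∀ u : 𝔼, u ∈ range (𝓡∂ m) ↔ 0 ≤ ℓ u := fun u ↦ by
    rw [range_modelWithCornersEuclideanHalfSpace]; rfl
  have hbd : ∀ x : M, x ∈ (𝓡∂ m).boundary M → ℓ (extChartAt (𝓡∂ m) x x) = 0 := fun x hx ↦ by
    have h : extChartAt (𝓡∂ m) x x ∈ frontier (range (𝓡∂ m)) := hx
    rw [frontier_range_modelWithCornersEuclideanHalfSpace] at h
    exact Eq.symm h
  -- In charts, the zeroth coordinate of `Φ` is nonnegative on the half-space and vanishes at the
  -- boundary point, which is therefore a minimum. Its derivative is nonnegative in all directions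
  -- pointing into the half-space.
  have hnonneg : ∀ w : 𝔼, 0 ≤ ℓ w → 0 ≤ ℓ (L w) := by
    intro w hw
    have hmin : IsLocalMinOn (fun u ↦ ℓ (writtenInExtChartAt (𝓡∂ m) (𝓡∂ m) z Φ u))
        (range (𝓡∂ m)) (extChartAt (𝓡∂ m) z z) := by
      refine Eventually.of_forall fun u ↦ ?_
      have h1 : writtenInExtChartAt (𝓡∂ m) (𝓡∂ m) z Φ (extChartAt (𝓡∂ m) z z) =
          extChartAt (𝓡∂ m) (Φ z) (Φ z) := by
        simp only [writtenInExtChartAt, Function.comp_apply, extChartAt_to_inv]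
      simp only [h1, hbd _ hΦz]
      exact (hrange _).1 ⟨_, rfl⟩
    have hd : HasFDerivWithinAt (fun u ↦ ℓ (writtenInExtChartAt (𝓡∂ m) (𝓡∂ m) z Φ u)) (ℓ.comp L)
        (range (𝓡∂ m)) (extChartAt (𝓡∂ m) z z) := ℓ.hasFDerivAt.comp_hasFDerivWithinAt _ hL
    refine hmin.hasFDerivWithinAt_nonneg (f' := ℓ.comp L) (y := w) hd
      (mem_posTangentConeAt_of_segment_subset ?_)
    refine (𝓡∂ m).convex_range.segment_subset ⟨_, rfl⟩ ((hrange _).2 ?_)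
    rw [map_add, hbd _ hz, zero_add]
    exact hw
  have hker : ∀ w : 𝔼, ℓ w = 0 → ℓ (L w) = 0 := by
    intro w hw
    have h1 := hnonneg w hw.ge
    have h2 := hnonneg (-w) (by rw [map_neg, hw, neg_zero])
    rw [map_neg, map_neg] at h2
    linarith
  let e : 𝔼 := EuclideanSpace.single 0 1
  have he : ℓ e = 1 := by simp [ℓ, e]
  -- The functional `ℓ ∘ L` vanishes on the kernel of `ℓ`, so it is a multiple of `ℓ`. The factor is
  -- nonnegative by `hnonneg`, and nonzero because `L` is surjective.
  have hdec : ∀ v : 𝔼, ℓ (L v) = ℓ (L e) * ℓ v := by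
    intro v
    have h := hker (v - ℓ v • e) (by rw [map_sub, map_smul, he]; simp)
    rw [map_sub, map_sub, map_smul, map_smul, smul_eq_mul, sub_eq_zero] at h
    rw [h, mul_comm]
  refine ⟨ℓ (L e), (hnonneg e (by rw [he]; exact zero_le_one)).lt_of_ne' fun h0 ↦ ?_, fun v ↦ ?_⟩
  · obtain ⟨v, hv⟩ := (Φ.mfderivToContinuousLinearEquiv (by simp) z).surjective e
    have hv' : L v = e := hv
    have := hdec v
    rw [hv', h0, he, zero_mul] at this
    exact one_ne_zero this
  · rw [normalCoord_eq, normalCoord_eq]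
    exact hdec v

variable [RiemannianBundle (fun x : M ↦ TangentSpace (𝓡∂ m) x)]

/-- A diffeomorphism is a Riemannian isometry if its differentials preserve inner products. -/
def IsRiemannianIsometry (Φ : M ≃ₘ^∞⟮𝓡∂ m, 𝓡∂ m⟯ M) : Prop :=
  ∀ (z : M) (v w : TangentSpace (𝓡∂ m) z),
    inner (E := TangentSpace (𝓡∂ m) (Φ z)) ℝ (mfderiv (𝓡∂ m) (𝓡∂ m) Φ z v)
      (mfderiv (𝓡∂ m) (𝓡∂ m) Φ z w) = inner (E := TangentSpace (𝓡∂ m) z) ℝ v w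

/-- Isometries preserve inward pointing unit normals. -/
lemma IsInwardNormal.map {Φ : M ≃ₘ^∞⟮𝓡∂ m, 𝓡∂ m⟯ M} (hΦ : IsRiemannianIsometry Φ) {z : M}
    (hz : z ∈ (𝓡∂ m).boundary M) {n : TangentSpace (𝓡∂ m) z} (hn : IsInwardNormal z n) :
    IsInwardNormal (Φ z) (mfderiv (𝓡∂ m) (𝓡∂ m) Φ z n) := by
  obtain ⟨c, hc, hcv⟩ := exists_pos_normalCoord_mfderiv Φ hz
  refine ⟨?_, fun v hv ↦ ?_, ?_⟩
  · have h1 := hΦ z n n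
    have h2 := hn.norm_eq_one
    rw [@norm_eq_sqrt_real_inner (TangentSpace (𝓡∂ m) z)] at h2
    rw [@norm_eq_sqrt_real_inner (TangentSpace (𝓡∂ m) (Φ z)), h1, h2]
  · obtain ⟨w, rfl⟩ : ∃ w, mfderiv (𝓡∂ m) (𝓡∂ m) Φ z w = v :=
      (Φ.mfderivToContinuousLinearEquiv (by simp) z).surjective v
    rw [hΦ]
    rw [hcv] at hv
    exact hn.orthogonal w ((mul_eq_zero.1 hv).resolve_left hc.ne')
  · rw [hcv]
    exact mul_pos hc hn.inward

variable [MeasurableSpace M] [BorelSpace M]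

lemma tangentJacobian_mfderiv_comp {Φ : M ≃ₘ^∞⟮𝓡∂ m, 𝓡∂ m⟯ M} (hΦ : IsRiemannianIsometry Φ)
    (z : M) (L : 𝔼 →L[ℝ] TangentSpace (𝓡∂ m) z) :
    tangentJacobian (Φ z) ((mfderiv (𝓡∂ m) (𝓡∂ m) Φ z).comp L) = tangentJacobian z L := by
  rw [tangentJacobian, tangentJacobian]
  congr 2
  ext i j
  exact hΦ z _ _

/-- Every chart volume is the push-forward of another one under a given isometry. -/
lemma exists_map_chartVolume_eq {Φ : M ≃ₘ^∞⟮𝓡∂ m, 𝓡∂ m⟯ M} (hΦ : IsRiemannianIsometry Φ)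
    {φ : OpenPartialHomeomorph M (EuclideanHalfSpace m)}
    (hφ : φ ∈ IsManifold.maximalAtlas (𝓡∂ m) ∞ M) :
    ∃ ψ ∈ IsManifold.maximalAtlas (𝓡∂ m) ∞ M, (chartVolume ψ).map Φ = chartVolume φ := by
  -- The chart `φ ∘ Φ` has inverse parametrization `Φ⁻¹ ∘ φ⁻¹`. Both charts thus share their
  -- coordinate domain, and the isometry makes their densities equal there.
  let ψ := Φ.toHomeomorph.transOpenPartialHomeomorph φ
  have hψ : ψ ∈ IsManifold.maximalAtlas (𝓡∂ m) ∞ M := by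
    refine OpenPartialHomeomorph.mem_maximalAtlas_of_contMDiffOn ψ ?_ ?_
    · exact (contMDiffOn_of_mem_maximalAtlas hφ).comp Φ.contMDiff.contMDiffOn fun x hx ↦ hx
    · exact Φ.symm.contMDiff.comp_contMDiffOn (contMDiffOn_symm_of_mem_maximalAtlas hφ)
  have hfun : ⇑(φ.extend (𝓡∂ m)).symm = Φ ∘ (ψ.extend (𝓡∂ m)).symm := by
    funext u
    exact (Φ.apply_symm_apply _).symm
  have htarget : (ψ.extend (𝓡∂ m)).target = (φ.extend (𝓡∂ m)).target := by
    rw [ψ.extend_target, φ.extend_target]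
    rfl
  have hdens : ∀ u ∈ (φ.extend (𝓡∂ m)).target, volumeDensity ψ u = volumeDensity φ u := by
    intro u hu
    have hd := mdifferentiableWithinAt_extend_symm hψ (htarget ▸ hu)
    have hu' : UniqueMDiffWithinAt 𝓘(ℝ, 𝔼) (range (𝓡∂ m)) u :=
      ((𝓡∂ m).uniqueDiffOn _ (φ.extend_target_subset_range hu)).uniqueMDiffWithinAt
    rw [volumeDensity, volumeDensity, hfun]
    rw [mfderiv_comp_mfderivWithin u ((Φ.contMDiff _).mdifferentiableAt (by simp)) hd hu']
    exact (tangentJacobian_mfderiv_comp hΦ _ _).symm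
  refine ⟨ψ, hψ, ?_⟩
  rw [chartVolume, chartVolume, hfun, htarget, AEMeasurable.map_map_of_aemeasurable]
  · congr 1
    refine withDensity_congr_ae ?_
    refine (ae_restrict_iff' (measurableSet_extend_target φ)).2 (.of_forall fun u hu ↦ ?_)
    simp only [hdens u hu]
  · exact Φ.contMDiff.continuous.measurable.aemeasurable
  · have := aemeasurable_extend_symm ψ
    rw [htarget] at this
    exact this

/-- Volume is the supremum of the chart volumes, and each of these is the push-forward of another,
hence bounded by the push-forward of the supremum. -/
lemma riemannianVolume_le_map {Φ : M ≃ₘ^∞⟮𝓡∂ m, 𝓡∂ m⟯ M} (hΦ : IsRiemannianIsometry Φ) :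
    riemannianVolume m M ≤ (riemannianVolume m M).map Φ := by
  refine iSup₂_le fun φ hφ ↦ ?_
  obtain ⟨ψ, hψ, h⟩ := exists_map_chartVolume_eq hΦ hφ
  rw [← h]
  refine Measure.map_mono ?_ Φ.contMDiff.continuous.measurable
  exact le_iSup₂ (f := fun (φ : OpenPartialHomeomorph M (EuclideanHalfSpace m))
    (_ : φ ∈ IsManifold.maximalAtlas (𝓡∂ m) ∞ M) ↦ chartVolume φ) ψ hψ

/-- Isometries preserve the Riemannian volume. -/
theorem measurePreserving_riemannianVolume {Φ : M ≃ₘ^∞⟮𝓡∂ m, 𝓡∂ m⟯ M}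
    (hΦ : IsRiemannianIsometry Φ) (hΦ' : IsRiemannianIsometry Φ.symm) :
    MeasurePreserving Φ (riemannianVolume m M) (riemannianVolume m M) := by
  have hm := Φ.contMDiff.continuous.measurable
  have hm' := Φ.symm.contMDiff.continuous.measurable
  refine ⟨hm, le_antisymm ?_ (riemannianVolume_le_map hΦ)⟩
  -- Pushing the inequality for the inverse forward by `Φ` gives the reverse inequality for `Φ`.
  have h := Measure.map_mono (riemannianVolume_le_map hΦ') hm
  rw [Measure.map_map hm hm'] at h
  convert h using 1
  have : Φ ∘ Φ.symm = id := funext Φ.apply_symm_apply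
  rw [this, Measure.map_id]

end Isometries

/-! ### Deck transformations as Riemannian isometries -/

section DeckDiffeomorphism

variable {m : ℕ} [NeZero m]
  {M₁ : Type*} [TopologicalSpace M₁] [ChartedSpace (EuclideanHalfSpace m) M₁]
  {M₂ : Type*} [TopologicalSpace M₂] [ChartedSpace (EuclideanHalfSpace m) M₂]
  {p : C^∞⟮𝓡∂ m, M₂; 𝓡∂ m, M₁⟯}

/-- Near `z`, a deck transformation equals `s ∘ p`, where `s` is the smooth local inverse of `p`
through `g z`. -/
lemma deckGroup_contMDiff (hp : IsLocalDiffeomorph (𝓡∂ m) (𝓡∂ m) ∞ p) (g : deckGroup p) :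
    ContMDiff (𝓡∂ m) (𝓡∂ m) ∞ g.1 := by
  intro z
  have h1 : ContMDiffAt (𝓡∂ m) (𝓡∂ m) ∞ (fun w ↦ (hp (g.1 z)).localInverse (p w)) z := by
    refine ContMDiffAt.comp z ?_ p.contMDiff.contMDiffAt
    have := (hp (g.1 z)).localInverse_contMDiffAt
    rwa [g.2 z] at this
  refine h1.congr_of_eventuallyEq ?_
  filter_upwards [g.1.continuous.continuousAt.eventually
    (hp (g.1 z)).localInverse_eventuallyEq_left] with w hw
  have hw' : (hp (g.1 z)).localInverse (p (g.1 w)) = g.1 w := hw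
  rw [g.2 w] at hw'
  exact hw'.symm

/-- A deck transformation, as a diffeomorphism. -/
def deckDiffeomorph (hp : IsLocalDiffeomorph (𝓡∂ m) (𝓡∂ m) ∞ p) (g : deckGroup p) :
    M₂ ≃ₘ^∞⟮𝓡∂ m, 𝓡∂ m⟯ M₂ where
  toEquiv := g.1.toEquiv
  contMDiff_toFun := deckGroup_contMDiff hp g
  contMDiff_invFun := deckGroup_contMDiff hp g⁻¹

lemma isRiemannianIsometry_deckDiffeomorph
    [RiemannianBundle (fun x : M₁ ↦ TangentSpace (𝓡∂ m) x)]
    [RiemannianBundle (fun z : M₂ ↦ TangentSpace (𝓡∂ m) z)]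
    (hp : IsRiemannianCovering p) (g : deckGroup p) :
    IsRiemannianIsometry (deckDiffeomorph hp.isLocalDiffeomorph g) := by
  intro z v w
  set Φ := deckDiffeomorph hp.isLocalDiffeomorph g with hΦ
  have hcomp : p ∘ Φ = p := funext g.2
  have hmf : mfderiv (𝓡∂ m) (𝓡∂ m) (p ∘ Φ) z =
      (mfderiv (𝓡∂ m) (𝓡∂ m) p (Φ z)).comp (mfderiv (𝓡∂ m) (𝓡∂ m) Φ z) :=
    mfderiv_comp z ((p.contMDiff _).mdifferentiableAt (by simp))
      ((Φ.contMDiff z).mdifferentiableAt (by simp))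
  -- Differentiating `p ∘ Φ = p` gives `dp ∘ dΦ = dp`, where `dp` is isometric. The tangent spaces
  -- at `p (Φ z)` and `p z` are different types, so the equality of maps is substituted for a
  -- variable `f`.
  have aux : ∀ f : M₂ → M₁, f = p →
      inner (E := TangentSpace (𝓡∂ m) (f z)) ℝ (mfderiv (𝓡∂ m) (𝓡∂ m) f z v)
        (mfderiv (𝓡∂ m) (𝓡∂ m) f z w) = inner (E := TangentSpace (𝓡∂ m) z) ℝ v w := by
    rintro _ rfl
    exact hp.isometric z v w
  have h := aux _ hcomp
  rw [hmf] at h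
  rw [← h]
  exact (hp.isometric (Φ z) _ _).symm

end DeckDiffeomorphism

/-! ### The action of deck transformations on sections -/

noncomputable section DeckAction

section FiberCast

variable {𝔽 : Type*} [RCLike 𝔽] {X : Type*} {V : X → Type*} [∀ x, NormedAddCommGroup (V x)]
  [∀ x, InnerProductSpace 𝔽 (V x)]

variable (𝔽) in
/-- The identification of the fibres of a bundle over equal points. -/
def fiberCast {x y : X} (h : x = y) : V x →ₗᵢ[𝔽] V y where
  toFun v := h ▸ v
  map_add' _ _ := by subst h; rfl
  map_smul' _ _ := by subst h; rfl
  norm_map' _ := by subst h; rfl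

lemma fiberCast_apply {x y : X} (h : x = y) (σ : Π x, V x) : fiberCast 𝔽 h (σ x) = σ y := by
  subst h; rfl

lemma totalSpace_mk_fiberCast {F : Type*} {x y : X} (h : x = y) (v : V x) :
    (⟨y, fiberCast 𝔽 h v⟩ : TotalSpace F V) = ⟨x, v⟩ := by
  subst h; rfl

end FiberCast

variable {m : ℕ} [NeZero m] {𝔽 : Type*} [RCLike 𝔽]
  {M₁ : Type*} [TopologicalSpace M₁] [ChartedSpace (EuclideanHalfSpace m) M₁]
  {M₂ : Type*} [TopologicalSpace M₂] [ChartedSpace (EuclideanHalfSpace m) M₂]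
  {F : Type*} [NormedAddCommGroup F] [NormedSpace 𝔽 F] [NormedSpace ℝ F] [IsScalarTower ℝ 𝔽 F]
  {V : M₁ → Type*} [TopologicalSpace (TotalSpace F V)] [∀ x, NormedAddCommGroup (V x)]
  [∀ x, InnerProductSpace 𝔽 (V x)] [∀ x, InnerProductSpace ℝ (V x)]
  [FiberBundle F V] [VectorBundle ℝ F V] [VectorBundle 𝔽 F V]
  {p : C^∞⟮𝓡∂ m, M₂; 𝓡∂ m, M₁⟯}

/-- The pullback `g^* η` of sections of `p^* E₁` along a deck transformation `g`. -/
def deckPullback (hp : IsLocalDiffeomorph (𝓡∂ m) (𝓡∂ m) ∞ p) (g : deckGroup p) :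
    pullbackSections 𝔽 F V p →ₗ[𝔽] pullbackSections 𝔽 F V p where
  -- The value `η (g z)` lies over `p (g z)` and is carried to the fibre over `p z`. As a map into
  -- the total space of `E₁` the result is just `η ∘ g`, hence smooth.
  toFun η := ⟨fun z ↦ fiberCast 𝔽 (g.2 z) (η.1 (g.1 z)), fun z ↦ by
    rw [contMDiffAt_pullback_iff]
    refine (((pullbackSections_contMDiff p η.2).comp
      (deckGroup_contMDiff hp g)) z).congr_of_eventuallyEq (.of_forall fun w ↦ ?_)
    exact totalSpace_mk_fiberCast _ _⟩
  map_add' η θ := Subtype.ext (funext fun _ ↦ map_add (fiberCast 𝔽 _) _ _)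
  map_smul' c η := Subtype.ext (funext fun _ ↦ map_smul (fiberCast 𝔽 _) c _)

lemma deckPullback_apply (hp : IsLocalDiffeomorph (𝓡∂ m) (𝓡∂ m) ∞ p) (g : deckGroup p)
    (η : pullbackSections 𝔽 F V p) (z : M₂) :
    (deckPullback hp g η).1 z = fiberCast 𝔽 (g.2 z) (η.1 (g.1 z)) := rfl

lemma deckPullback_mem_compactSections (hp : IsLocalDiffeomorph (𝓡∂ m) (𝓡∂ m) ∞ p)
    (g : deckGroup p) {η : pullbackSections 𝔽 F V p} (hη : η ∈ compactSections 𝔽 F V p) :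
    deckPullback hp g η ∈ compactSections 𝔽 F V p := by
  have h : {z | (deckPullback hp g η).1 z ≠ 0} = g.1 ⁻¹' {z | η.1 z ≠ 0} := by
    ext z
    change (deckPullback hp g η).1 z ≠ 0 ↔ η.1 (g.1 z) ≠ 0
    rw [deckPullback_apply, Ne, map_eq_zero_iff _ (fiberCast 𝔽 (g.2 z)).injective]
  change IsCompact (closure {z | (deckPullback hp g η).1 z ≠ 0})
  rw [h, ← g.1.preimage_closure, g.1.isCompact_preimage]
  exact hη

/-- Because `p ∘ g = p`, one section `σ` of `E₁` represents `η` near `g z` and `g^* η` near `z`. The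
lifted operator and connection are computed from such a `σ`, so they commute with `g^*`. -/
lemma deckPullback_eventually (hp : IsLocalDiffeomorph (𝓡∂ m) (𝓡∂ m) ∞ p) (g : deckGroup p)
    {η : pullbackSections 𝔽 F V p} {z : M₂} {σ : Π x, V x}
    (hσ : ∀ᶠ w in 𝓝 (g.1 z), σ (p w) = η.1 w) :
    ∀ᶠ w in 𝓝 z, σ (p w) = (deckPullback hp g η).1 w := by
  filter_upwards [g.1.continuous.continuousAt.eventually hσ] with w hw
  rw [deckPullback_apply, ← hw]
  exact (fiberCast_apply (g.2 w) σ).symm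

variable [IsManifold (𝓡∂ m) ∞ M₁] [T2Space M₁]

/-- The lifted operator commutes with deck transformations. -/
lemma liftOperator_deckPullback (hp : IsLocalDiffeomorph (𝓡∂ m) (𝓡∂ m) ∞ p)
    (D : DifferentialOperator m 𝔽 F V) (g : deckGroup p) (η : pullbackSections 𝔽 F V p) :
    liftOperator hp D (deckPullback hp g η) = deckPullback hp g (liftOperator hp D η) := by
  refine Subtype.ext (funext fun z ↦ ?_)
  obtain ⟨σ, hσ⟩ := exists_extension hp (g.1 z) η
  change liftValue hp D (deckPullback hp g η) z = fiberCast 𝔽 (g.2 z) (liftValue hp D η (g.1 z))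
  rw [liftValue_eq hp D η (g.1 z) hσ,
    liftValue_eq hp D _ z (deckPullback_eventually hp g hσ)]
  exact (fiberCast_apply (g.2 z) _).symm

/-- The pullback connection commutes with deck transformations. -/
lemma pullbackCov_deckPullback (hp : IsLocalDiffeomorph (𝓡∂ m) (𝓡∂ m) ∞ p)
    (nabla : Connection m 𝔽 F V) (g : deckGroup p) (η : pullbackSections 𝔽 F V p) (z : M₂)
    (v : TangentSpace (𝓡∂ m) z) :
    pullbackCov hp nabla (deckPullback hp g η).1 z v =
      fiberCast 𝔽 (g.2 z) (pullbackCov hp nabla η.1 (g.1 z)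
        (mfderiv (𝓡∂ m) (𝓡∂ m) g.1 z v)) := by
  obtain ⟨σ, hσ⟩ := exists_extension hp (g.1 z) η
  rw [pullbackCov_eq hp nabla η _ _ hσ,
    pullbackCov_eq hp nabla _ z v (deckPullback_eventually hp g hσ)]
  have hmf : mfderiv (𝓡∂ m) (𝓡∂ m) (p ∘ g.1) z =
      (mfderiv (𝓡∂ m) (𝓡∂ m) p (g.1 z)).comp (mfderiv (𝓡∂ m) (𝓡∂ m) g.1 z) :=
    mfderiv_comp z ((p.contMDiff _).mdifferentiableAt (by simp))
      ((deckGroup_contMDiff hp g z).mdifferentiableAt (by simp))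
  have aux : ∀ (f : M₂ → M₁) (_ : f = p) (h : f z = p z),
      fiberCast 𝔽 h (nabla.cov σ.1 (f z) (mfderiv (𝓡∂ m) (𝓡∂ m) f z v)) =
        nabla.cov σ.1 (p z) (mfderiv (𝓡∂ m) (𝓡∂ m) p z v) := by
    rintro _ rfl _
    rfl
  have h := aux (p ∘ g.1) (funext g.2) (g.2 z)
  rw [hmf] at h
  exact h.symm

variable [IsManifold (𝓡∂ m) ∞ M₂]
  [RiemannianBundle (fun x : M₁ ↦ TangentSpace (𝓡∂ m) x)]
  [RiemannianBundle (fun z : M₂ ↦ TangentSpace (𝓡∂ m) z)]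

/-- Deck transformations preserve the boundary condition. -/
lemma deckPullback_mem_boundaryDomain (hp : IsRiemannianCovering p) (nabla : Connection m 𝔽 F V)
    (a b : M₁ → 𝔽) (g : deckGroup p) {η : compactSections 𝔽 F V p}
    (hη : η ∈ boundaryDomain hp.isLocalDiffeomorph nabla a b) :
    (⟨_, deckPullback_mem_compactSections hp.isLocalDiffeomorph g η.2⟩ :
      compactSections 𝔽 F V p) ∈ boundaryDomain hp.isLocalDiffeomorph nabla a b := by
  intro z hz n hn
  have hz' : g.1 z ∈ (𝓡∂ m).boundary M₂ :=
    ((deckDiffeomorph hp.isLocalDiffeomorph g).isLocalDiffeomorph z).isBoundaryPoint_iff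
      (by simp) |>.1 hz
  -- The boundary condition for `g^* η` at `z` is that for `η` at `g z`, with the image normal `dg
  -- n`. The coefficients agree because they factor through `p`.
  have h := hη (g.1 z) hz' _ (hn.map (isRiemannianIsometry_deckDiffeomorph hp g) hz)
  have h2 := congrArg (fiberCast 𝔽 (g.2 z)) h
  rw [map_add, map_smul, map_smul, map_zero, congrArg a (g.2 z),
    congrArg b (g.2 z)] at h2
  change a (p z) • pullbackCov _ nabla (deckPullback _ g η.1).1 z n +
    b (p z) • (deckPullback _ g η.1).1 z = 0
  rw [pullbackCov_deckPullback]
  exact h2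

variable [IsContMDiffRiemannianBundle (𝓡∂ m) ∞ (EuclideanSpace ℝ (Fin m))
    (fun z : M₂ ↦ TangentSpace (𝓡∂ m) z)]
  [MeasurableSpace M₂] [BorelSpace M₂] [IsContMDiffRiemannianBundle (𝓡∂ m) ∞ F V]

/-- The pullback of compactly supported sections along a deck transformation, as an isometry for
the `L²` norm. -/
def deckIsometry (hp : IsRiemannianCovering p) (g : deckGroup p) :
    TestSection 𝔽 F V p →ₗᵢ[𝔽] TestSection 𝔽 F V p :=
  LinearMap.isometryOfInner
    ((deckPullback hp.isLocalDiffeomorph g).restrict (p := compactSections 𝔽 F V p)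
      (q := compactSections 𝔽 F V p)
      fun _ h ↦ deckPullback_mem_compactSections hp.isLocalDiffeomorph g h :
      TestSection 𝔽 F V p →ₗ[𝔽] TestSection 𝔽 F V p) fun η θ ↦ by
    -- Pointwise, the inner product of `g^* η` and `g^* θ` at `z` is that of `η` and `θ` at `g z`;
    -- the integrals agree since `g` preserves volume.
    have h := (measurePreserving_riemannianVolume (isRiemannianIsometry_deckDiffeomorph hp g)
      (isRiemannianIsometry_deckDiffeomorph hp g⁻¹)).integral_comp
      g.1.measurableEmbedding fun z ↦ inner 𝔽 (η.1.1 z) (θ.1.1 z)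
    refine Eq.trans (integral_congr_ae (.of_forall fun z ↦ ?_)) h
    exact (fiberCast 𝔽 (g.2 z)).inner_map_map _ _

end DeckAction

/-! ### The induced isometries of the `L²` space -/

section DeckUnitary

variable {m : ℕ} [NeZero m] {𝔽 : Type*} [RCLike 𝔽]
  {M₁ : Type*} [TopologicalSpace M₁] [ChartedSpace (EuclideanHalfSpace m) M₁]
  [IsManifold (𝓡∂ m) ∞ M₁] [T2Space M₁]
  [RiemannianBundle (fun x : M₁ ↦ TangentSpace (𝓡∂ m) x)]
  {M₂ : Type*} [TopologicalSpace M₂] [ChartedSpace (EuclideanHalfSpace m) M₂]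
  [IsManifold (𝓡∂ m) ∞ M₂]
  [RiemannianBundle (fun z : M₂ ↦ TangentSpace (𝓡∂ m) z)]
  [IsContMDiffRiemannianBundle (𝓡∂ m) ∞ (EuclideanSpace ℝ (Fin m))
    (fun z : M₂ ↦ TangentSpace (𝓡∂ m) z)]
  [MeasurableSpace M₂] [BorelSpace M₂]
  {F : Type*} [NormedAddCommGroup F] [NormedSpace 𝔽 F] [NormedSpace ℝ F] [IsScalarTower ℝ 𝔽 F]
  {V : M₁ → Type*} [TopologicalSpace (TotalSpace F V)] [∀ x, NormedAddCommGroup (V x)]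
  [∀ x, InnerProductSpace 𝔽 (V x)] [∀ x, InnerProductSpace ℝ (V x)]
  [FiberBundle F V] [VectorBundle ℝ F V] [VectorBundle 𝔽 F V]
  [IsContMDiffRiemannianBundle (𝓡∂ m) ∞ F V]
  {p : C^∞⟮𝓡∂ m, M₂; 𝓡∂ m, M₁⟯}

/-- For all but finitely many deck transformations `g`, the sections `g^* η` and `θ` are
orthogonal. -/
lemma eventually_inner_deckIsometry_eq_zero [PreconnectedSpace M₂]
    (hp : IsRiemannianCovering p) (η θ : TestSection 𝔽 F V p) :
    ∀ᶠ g : deckGroup p in cofinite, inner 𝔽 θ (deckIsometry hp g η) = 0 := by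
  have : LocallyConnectedSpace M₂ := ChartedSpace.locallyConnectedSpace (EuclideanHalfSpace m) M₂
  -- If `g` carries no point of the support of `θ` into that of `η`, then the integrand vanishes
  -- everywhere.
  refine (finite_setOf_deckGroup hp.isCoveringMap θ.2 η.2).subset fun g hg ↦ ?_
  by_contra hcon
  refine hg (integral_eq_zero_of_ae (.of_forall fun z ↦ ?_))
  change inner 𝔽 (θ.1.1 z) (fiberCast 𝔽 (g.2 z) (η.1.1 (g.1 z))) = 0
  by_cases hθ : θ.1.1 z = 0
  · rw [hθ, inner_zero_left]
  by_cases hη : η.1.1 (g.1 z) = 0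
  · rw [hη, map_zero, inner_zero_right]
  exact (hcon ⟨z, subset_closure hθ, subset_closure hη⟩).elim

/-- The graph of the lifted operator is invariant under isometries of `L²` that extend the action
of deck transformations on sections. -/
lemma liftedOperator_graph_invariant (hp : IsRiemannianCovering p)
    (D : DifferentialOperator m 𝔽 F V) (nabla : Connection m 𝔽 F V) (a b : M₁ → 𝔽)
    (g : deckGroup p) {U : L2Sections 𝔽 F V p →ₗᵢ[𝔽] L2Sections 𝔽 F V p}
    (hU : ∀ η : TestSection 𝔽 F V p, U η = (deckIsometry hp g η : L2Sections 𝔽 F V p)) :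
    ∀ x ∈ (liftedOperator hp.isLocalDiffeomorph D nabla a b).graph,
      (U x.1, U x.2) ∈ (liftedOperator hp.isLocalDiffeomorph D nabla a b).graph := by
  rintro ⟨x, y⟩ hxy
  obtain ⟨⟨_, η, hη, rfl⟩, hx, hy⟩ := (LinearPMap.mem_graph_iff _).1 hxy
  simp only at hx hy ⊢
  subst hx hy
  rw [liftedOperator_apply hp.isLocalDiffeomorph D nabla a b hη]
  have h1 : U (toL2 𝔽 F V p η) = toL2 𝔽 F V p (deckIsometry hp g η) := hU η
  have h2 : U (toL2 𝔽 F V p (testLift hp.isLocalDiffeomorph D η)) =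
      toL2 𝔽 F V p (testLift hp.isLocalDiffeomorph D (deckIsometry hp g η)) := by
    refine (hU _).trans (congrArg (toL2 𝔽 F V p) (Subtype.ext ?_))
    exact (liftOperator_deckPullback hp.isLocalDiffeomorph D g η.1).symm
  have hη' : deckIsometry hp g η ∈ testDomain hp.isLocalDiffeomorph nabla a b :=
    deckPullback_mem_boundaryDomain hp nabla a b g hη
  rw [h1, h2, ← liftedOperator_apply hp.isLocalDiffeomorph D nabla a b hη']
  exact LinearPMap.mem_graph _ ⟨_, Submodule.mem_map_of_mem hη'⟩

end DeckUnitary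

end RiemCover

/-! ### Conclusion -/

theorem mainTheorem7 {m : ℕ} [NeZero m] {𝔽 : Type*} [RCLike 𝔽]
    -- the Riemannian manifolds `M₁`, `M₂`
    {M₁ : Type*} [TopologicalSpace M₁] [ChartedSpace (EuclideanHalfSpace m) M₁]
    [IsManifold (𝓡∂ m) ∞ M₁] [T2Space M₁] [SecondCountableTopology M₁] [ConnectedSpace M₁]
    [RiemannianBundle (fun x : M₁ ↦ TangentSpace (𝓡∂ m) x)]
    [IsContMDiffRiemannianBundle (𝓡∂ m) ∞ (EuclideanSpace ℝ (Fin m))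
      (fun x : M₁ ↦ TangentSpace (𝓡∂ m) x)]
    {M₂ : Type*} [TopologicalSpace M₂] [ChartedSpace (EuclideanHalfSpace m) M₂]
    [IsManifold (𝓡∂ m) ∞ M₂] [T2Space M₂] [SecondCountableTopology M₂] [ConnectedSpace M₂]
    [RiemannianBundle (fun z : M₂ ↦ TangentSpace (𝓡∂ m) z)]
    [IsContMDiffRiemannianBundle (𝓡∂ m) ∞ (EuclideanSpace ℝ (Fin m))
      (fun z : M₂ ↦ TangentSpace (𝓡∂ m) z)]
    [MeasurableSpace M₂] [BorelSpace M₂]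
    -- the Riemannian or Hermitian vector bundle `V` over `M₁`, with fibre `F`
    {F : Type*} [NormedAddCommGroup F] [NormedSpace 𝔽 F] [NormedSpace ℝ F] [IsScalarTower ℝ 𝔽 F]
    [FiniteDimensional 𝔽 F]
    {V : M₁ → Type*} [TopologicalSpace (TotalSpace F V)] [∀ x, NormedAddCommGroup (V x)]
    [∀ x, InnerProductSpace 𝔽 (V x)] [∀ x, InnerProductSpace ℝ (V x)]
    [∀ x, IsScalarTower ℝ 𝔽 (V x)] [FiberBundle F V] [VectorBundle ℝ F V] [VectorBundle 𝔽 F V]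
    [ContMDiffVectorBundle ∞ F V (𝓡∂ m)] [IsContMDiffRiemannianBundle (𝓡∂ m) ∞ F V]
    -- the covering, the operator on `V`, and the boundary condition
    {p : C^∞⟮𝓡∂ m, M₂; 𝓡∂ m, M₁⟯} (hp : RiemCover.IsRiemannianCovering p)
    (D : RiemCover.DifferentialOperator m 𝔽 F V) (nabla : RiemCover.Connection m 𝔽 F V)
    (a b : M₁ → 𝔽)
    (hsa : RiemCover.IsEssentiallySelfAdjoint
      (RiemCover.liftedOperator hp.isLocalDiffeomorph D nabla a b))
    (hdeck : Infinite (RiemCover.deckGroup p)) :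
    (∀ μ : 𝔽, ¬ RiemCover.IsEigenvalueOfFiniteMultiplicity
      (RiemCover.liftedOperator hp.isLocalDiffeomorph D nabla a b).closure μ) ∧
    RiemCover.spectrum (RiemCover.liftedOperator hp.isLocalDiffeomorph D nabla a b).closure =
      RiemCover.essSpectrum
        (RiemCover.liftedOperator hp.isLocalDiffeomorph D nabla a b).closure := by
  choose U hU using fun g : RiemCover.deckGroup p ↦
    RiemCover.exists_completion_linearIsometry
      (RiemCover.deckIsometry (𝔽 := 𝔽) (F := F) (V := V) hp g)
  have hweak : ∀ u v : RiemCover.L2Sections 𝔽 F V p,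
      Tendsto (fun g ↦ inner 𝔽 v (U g u)) cofinite (𝓝 0) := by
    refine RiemCover.tendsto_inner_zero_of_dense
      (UniformSpace.Completion.denseRange_coe (α := RiemCover.TestSection 𝔽 F V p)) ?_
    rintro _ ⟨η, rfl⟩ _ ⟨θ, rfl⟩
    refine tendsto_nhds_of_eventually_eq ?_
    filter_upwards [RiemCover.eventually_inner_deckIsometry_eq_zero hp η θ] with g hg
    rw [hU, UniformSpace.Completion.inner_coe, hg]
  -- Here the infinitude of the deck group enters: it makes `cofinite` a proper filter, so that
  -- limits along it are unique.
  have hfin := RiemCover.not_isEigenvalueOfFiniteMultiplicity hweak hsa.isClosable fun g ↦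
    RiemCover.liftedOperator_graph_invariant hp D nabla a b g (hU g)
  exact ⟨hfin, RiemCover.spectrum_eq_essSpectrum hsa.isSelfAdjoint hfin⟩
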